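/- **Trees.** $\mathcal T$ is the set of binary trees (each node has a possibly empty left and right subtree), including the empty tree $\Lambda$; $\mathcal T_n$ is the set of those with $n$ nodes; $|t|$ is the number of nodes and $h(t)$ the height of $t$, with $h(\Lambda)=0$ and $h(t)=1+\max(h(t_\ell),h(t_r))$. For a node $v$ of $t$, $t[v]$ is the subtree of $v$ and all its descendants, $t_\ell[v]$, $t_r[v]$ are its left and right subtree, and $n_{\ge b}(t)$ is the number of nodes $v$ with $|t[v]|\ge b$. $\lg=\log_2$. **Sources.** A *fixed-size source* is a function $p:\mathbb N_0^2\to[0,1]$ with $\sum_{\ell=0}^n p(\ell,n-\ell)=1$ for all $n\ge0$; it gives each tree the probability $\mathbb P[t]=\prod_{v\in t}p(|t_\ell[v]|,|t_r[v]|)$, and $H_n=\sum_{t\in\mathcal T_n}\mathbb P[t]\lg(1/\mathbb P[t])$ (with $0\lg(1/0)=0$). A *fixed-height source* is a function $p:\mathbb N_0^2\to[0,1]$ with $\sum_{\max(i,j)=h}p(i,j)=1$ for all $h\ge0$; it gives each tree the probability $\mathbb P[t]=\prod_{v\in t}p(h(t_\ell[v]),h(t_r[v]))$. Let $B:\mathbb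 N_0\to\mathbb R$ with $B(n)=\Theta(\log n)$. A fixed-size or fixed-height source is *worst-case $B$-fringe-dominated* if there is a function $f(n)=o(n/\log B(n))$ with $n_{\ge B(n)}(t)\le f(n)$ for all $n$ and all $t\in\mathcal T_n$ with $\mathbb P[t]>0$. A fixed-size source is *average-case $B$-fringe-dominated* if $\sum_{t\in\mathcal T_n}\mathbb P[t]\,n_{\ge B(n)}(t)=o(n/\log B(n))$. **Hypersuccinct code.** For $t\in\mathcal T_n$ let $\beta=\beta(n)=\max\{1,\lceil\frac18\lg n\rceil\}$ (with $\beta(0)=1$) and $\mu=\lceil\frac14\lg n\rceil$ (with $\mu=0$ for $n=0$). Decompose $t$ bottom-up into *micro trees* by the Farzan–Munro algorithm: call a node $v$ *heavy* if $|t[v]|\ge\beta$; if both children of $v$ are heavy, the components containing the children are declared permanent and $\{v\}$ is a permanent component by itself; otherwise $v$ is joined with those components of its children that are not yet permanent, and the resulting component is declared permanent if it has at least $\beta$ nodes; finally the component of the root is declared permanent. The permanent components $\mu_1,\dots,\mu_m$ (identified with their shapes) are the micro trees. Contracting each of them to a node gives a binary tree $\Upsilon$, the top tier: a child micro tree is the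 left (right) child in $\Upsilon$ if it lies in the left (right) subtree of the root of its parent micro tree. The null pointer of a micro tree at which a child micro tree was cut off is a *portal*. The micro trees are listed in depth-first order of $\Upsilon$. Let $\gamma(k)$ be the Elias gamma code of $k\ge1$ (put $\gamma(0)=\mathtt 0$), let $\mathit{BP}(\Lambda)=\varepsilon$ and $\mathit{BP}(t)=\mathtt 1\,\mathit{BP}(t_\ell)\,\mathtt 0\,\mathit{BP}(t_r)$ otherwise, let $C$ be the Huffman code for the string $\mu_1\dots\mu_m$ (if only one shape occurs, its codeword is empty), and let $\bar C(s)=\mathtt 0\,\gamma(|s|+1)\,\mathit{BP}(s)$ if $|C(s)|>2|s|+2\lfloor\lg(|s|+1)\rfloor$ and $\bar C(s)=\mathtt 1\,C(s)$ otherwise. Then $\mathsf H(t)\in\{0,1\}^\star$ is the concatenation of: (1) $\gamma(n)\gamma(m)$; (2) $\mathit{BP}(\Upsilon)$; (3) $\gamma$ of the number of distinct shapes among the $\mu_i$, and for each of these shapes $s$ the word $\gamma(|\bar C(s)|)\,\bar C(s)\,\gamma(|s|)\,\mathit{BP}(s)$; (4) $\bar C(\mu_1)\cdots\bar C(\mu_m)$;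 (5) for each $i$ the ranks of the portals of $\mu_i$ to its left and to its right child micro tree (in left-to-right order of the null pointers of $\mu_i$, counted from $0$; $0$ if there is no such child), as two integers of $\lceil\lg(\mu+1)\rceil$ bits. **Theorem.** 1. (Worst case.) Let $B(n)=\Theta(\log n)$ and let $p$ be a fixed-size or a fixed-height source that is worst-case $B$-fringe-dominated. Then there is a function $g(n)=o(n)$ such that $|\mathsf H(t)|\le\lg(1/\mathbb P[t])+g(n)$ for all $n$ and all $t\in\mathcal T_n$ with $\mathbb P[t]>0$. 2. (Average case.) Let $B(n)=\Theta(\log n)$ and let $p$ be a fixed-size source that is average-case $B$-fringe-dominated. Then $\sum_{t\in\mathcal T_n}\mathbb P[t]\,|\mathsf H(t)|\le H_n+o(n)$. 3. (Great-branching bound.) There are absolute constants $K$ and $N$ such that for every fixed-size or fixed-height source, every $n\ge N$ and every $t\in\mathcal T_n$ with $\mathbb P[t]>0$, $$\sum_{i=1}^m|C(\mu_i)|\le\lg\frac1{\mathbb P[t]}+K\,n_{\ge\beta(n)}(t)\,\lg\beta(n).$$ -/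

import Mathlib

open Filter Asymptotics

namespace Hypersuccinct

/-! ### Binary trees

The set of binary trees is Mathlib's `BinaryTree Unit`: `BinaryTree.nil` is the empty tree,
`BinaryTree.numNodes` is the size, `BinaryTree.height` the height (the empty tree has height `0`)
and `BinaryTree.treesOfNumNodesEq n` is the finite set of binary trees with `n` nodes. -/

/-- The number of nodes `v` of `t` whose fringe subtree `t[v]` has at least `b` nodes. -/
noncomputable def numHeavy (b : ℝ) : BinaryTree Unit → ℕ
  | .nil => 0
  | .node a l r =>
      (open Classical in if b ≤ ((BinaryTree.node a l r).numNodes : ℝ) then 1 else 0)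
        + numHeavy b l + numHeavy b r

/-! ### Tree sources -/

/-- `p` defines a fixed-size binary tree source. -/
structure IsFixedSizeSource (p : ℕ → ℕ → ℝ) : Prop where
  nonneg : ∀ i j, 0 ≤ p i j
  le_one : ∀ i j, p i j ≤ 1
  sum_eq_one : ∀ n, ∑ l ∈ Finset.range (n + 1), p l (n - l) = 1

/-- `p` defines a fixed-height binary tree source. -/
structure IsFixedHeightSource (p : ℕ → ℕ → ℝ) : Prop where
  nonneg : ∀ i j, 0 ≤ p i j
  le_one : ∀ i j, p i j ≤ 1
  sum_eq_one : ∀ h, ∑ ij ∈ (Finset.range (h + 1) ×ˢ Finset.range (h + 1)).filter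
      (fun ij => max ij.1 ij.2 = h), p ij.1 ij.2 = 1

/-- The probability `∏ v ∈ t, p (|t_ℓ[v]|, |t_r[v]|)` of a tree under a fixed-size source. -/
def fixedSizeProb (p : ℕ → ℕ → ℝ) : BinaryTree Unit → ℝ
  | .nil => 1
  | .node _ l r => p l.numNodes r.numNodes * fixedSizeProb p l * fixedSizeProb p r

/-- The probability `∏ v ∈ t, p (h(t_ℓ[v]), h(t_r[v]))` of a tree under a fixed-height source. -/
def fixedHeightProb (p : ℕ → ℕ → ℝ) : BinaryTree Unit → ℝ
  | .nil => 1
  | .node _ l r => p l.height r.height * fixedHeightProb p l * fixedHeightProb p r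

/-- The entropy, in bits, of the distribution that `P` induces on the trees with `n` nodes.
(A term with `P t = 0` is `0`.) -/
noncomputable def sizeEntropy (P : BinaryTree Unit → ℝ) (n : ℕ) : ℝ :=
  ∑ t ∈ BinaryTree.treesOfNumNodesEq n, P t * Real.logb 2 (1 / P t)

/-- Worst-case `B`-fringe dominance: `B(n) = Θ(log n)` and, uniformly over all trees `t` with `n`
nodes and positive probability, `n_{≥ B(n)}(t) = o(n / log B(n))`. -/
def WorstCaseFringeDominated (B : ℕ → ℝ) (P : BinaryTree Unit → ℝ) : Prop :=
  B =Θ[atTop] (fun n : ℕ => Real.log n) ∧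
  ∃ f : ℕ → ℝ, f =o[atTop] (fun n : ℕ => (n : ℝ) / Real.log (B n)) ∧
    ∀ t : BinaryTree Unit, 0 < P t → (numHeavy (B t.numNodes) t : ℝ) ≤ f t.numNodes

/-- Average-case `B`-fringe dominance: `B(n) = Θ(log n)` and the expectation of `n_{≥ B(n)}(t)` over
the trees with `n` nodes is `o(n / log B(n))`. -/
def AverageCaseFringeDominated (B : ℕ → ℝ) (P : BinaryTree Unit → ℝ) : Prop :=
  B =Θ[atTop] (fun n : ℕ => Real.log n) ∧
  (fun n : ℕ => ∑ t ∈ BinaryTree.treesOfNumNodesEq n, P t * (numHeavy (B n) t : ℝ))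
    =o[atTop] (fun n : ℕ => (n : ℝ) / Real.log (B n))

/-! ### Elementary codes

Bits are Booleans, `false` for `0` and `true` for `1`. -/

/-- The `w`-bit binary representation of `k`, most significant bit first. -/
def fixedWidth (w k : ℕ) : List Bool :=
  (List.range w).reverse.map k.testBit

/-- The Elias gamma code of `k ≥ 1`: `⌊lg k⌋` zeros, followed by the binary representation of `k`.
(For `k = 0`, which has no Elias gamma code, the value is the single bit `0`; this is used for the
empty tree only.) -/
def eliasGamma (k : ℕ) : List Bool :=
  List.replicate (Nat.log 2 k) false ++ fixedWidth (Nat.log 2 k + 1) k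

/-- The balanced-parenthesis encoding of a binary tree, `true` for `(` and `false` for `)`. -/
def balancedParens {α : Type*} : BinaryTree α → List Bool
  | .nil => []
  | .node _ l r => true :: (balancedParens l ++ false :: balancedParens r)

/-- The length-restricted version of a code for binary trees. -/
def lengthRestricted (C : BinaryTree Unit → List Bool) (t : BinaryTree Unit) : List Bool :=
  if 2 * t.numNodes + 2 * Nat.log 2 (t.numNodes + 1) < (C t).length then
    false :: (eliasGamma (t.numNodes + 1) ++ balancedParens t)
  else true :: C t

/-! ### Huffman codes -/

/-- Code trees, with the symbols at the leaves and a weight at every leaf. -/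
inductive HuffTree (α : Type*) where
  | leaf (weight : ℕ) (a : α) : HuffTree α
  | node (l r : HuffTree α) : HuffTree α

/-- The total weight of a code tree. -/
def HuffTree.weight {α : Type*} : HuffTree α → ℕ
  | .leaf w _ => w
  | .node l r => l.weight + r.weight

/-- The list of the symbols of a code tree, each with its codeword: the path from the root. -/
def HuffTree.codewords {α : Type*} : HuffTree α → List (α × List Bool)
  | .leaf _ a => [(a, [])]
  | .node l r => l.codewords.map (fun x => (x.1, false :: x.2))
      ++ r.codewords.map (fun x => (x.1, true :: x.2))

/-- Insertion into a list of code trees that is sorted by weight. -/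
def insertByWeight {α : Type*} (a : HuffTree α) : List (HuffTree α) → List (HuffTree α)
  | [] => [a]
  | b :: l => if a.weight ≤ b.weight then a :: b :: l else b :: insertByWeight a l

theorem length_insertByWeight {α : Type*} (a : HuffTree α) (l : List (HuffTree α)) :
    (insertByWeight a l).length = l.length + 1 := by
  induction l with
  | nil => rfl
  | cons b l ih =>
    unfold insertByWeight
    split
    · rfl
    · simp [ih]

/-- Huffman's algorithm on a list of code trees that is sorted by weight: as long as there are at
least two trees, the two lightest ones are merged. The result is `none` for the empty list only. -/
def huffmanMerge {α : Type*} : List (HuffTree α) → Option (HuffTree α)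
  | [] => none
  | [a] => some a
  | a :: b :: l => huffmanMerge (insertByWeight (.node a b) l)
termination_by l => l.length
decreasing_by simp [length_insertByWeight]

/-- The Huffman code for the string `s`, i.e. for the symbols that occur in `s`, weighted with
their numbers of occurrences. (Symbols that do not occur in `s` get the empty word.) -/
def huffmanCode {α : Type*} [DecidableEq α] (s : List α) (a : α) : List Bool :=
  match huffmanMerge ((s.dedup.map (fun b => HuffTree.leaf (s.count b) b)).foldr
      insertByWeight []) with
  | none => []
  | some T => (T.codewords.lookup a).getD []

/-! ### The Farzan–Munro decomposition

The decomposition of a binary tree into components is represented by a Boolean mark on each node: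
a node is marked if it is the root of a component that has been declared permanent, so the edge to
its parent is cut. The component of a node consists of the nodes that are connected to it by edges
that are not cut. -/

/-- The number of nodes in the active (that is, not yet permanent) component containing the root;
`0` if the component of the root is permanent. -/
def activeSize : BinaryTree Bool → ℕ
  | .nil => 0
  | .node true _ _ => 0
  | .node false l r => activeSize l + activeSize r + 1

/-- Declare the component that contains the root permanent. -/
def declarePermanent : BinaryTree Bool → BinaryTree Bool
  | .nil => .nil
  | .node _ l r => .node true l r

/-- The Farzan–Munro algorithm with parameter `B` on binary trees. A node `v` with two heavy
children (children whose fringe subtree has at least `B` nodes) forms a permanent component by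
itself, and the components of its children are declared permanent. Every other node `v` forms a
component with the components of its children that are not permanent, and this component is
declared permanent as soon as it has at least `B` nodes. -/
def farzanMunro (B : ℕ) : BinaryTree Unit → BinaryTree Bool
  | .nil => .nil
  | .node _ l r =>
      if B ≤ l.numNodes ∧ B ≤ r.numNodes then
        .node true (declarePermanent (farzanMunro B l)) (declarePermanent (farzanMunro B r))
      else
        .node (decide (B ≤ activeSize (farzanMunro B l) + activeSize (farzanMunro B r) + 1))
          (farzanMunro B l) (farzanMunro B r)

/-- A micro tree: its shape, and the ranks (counted from `0`, from left to right, among all null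
pointers of the shape) of the portals to its left and right child micro tree; the entry for a child
that does not exist is `0`. -/
structure MicroTree where
  shape : BinaryTree Unit
  leftPortal : ℕ
  rightPortal : ℕ

/-- Is the tree nonempty? -/
def isNonempty {α : Type*} : BinaryTree α → Bool
  | .nil => false
  | .node _ _ _ => true

/-- The rank of the first portal in a list of null pointers (`0` if there is none), where the null
pointers that are not portals carry the empty tree. -/
def portalRank {α : Type*} (hs : List (BinaryTree α)) : ℕ :=
  if hs.any isNonempty then hs.findIdx isNonempty else 0

/-- The tree at the first portal in a list of null pointers (the empty tree if there is none). -/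
def portalTree {α : Type*} (hs : List (BinaryTree α)) : BinaryTree α :=
  (hs.find? isNonempty).getD .nil

/-- For a tree with marked component roots: the shape of the part of the tree above all marked nodes,
and the list of its null pointers from left to right, where each null pointer carries the contracted
tree of the micro trees below it (the empty tree if it is also a null pointer of the given tree). -/
def contract : BinaryTree Bool → BinaryTree Unit × List (BinaryTree MicroTree)
  | .nil => (.nil, [.nil])
  | .node c l r =>
      let L := contract l
      let R := contract r
      let s : BinaryTree Unit := .node () L.1 R.1
      if c then
        (.nil, [.node
          { shape := s
            leftPortal := portalRank L.2
            rightPortal := if R.2.any isNonempty then L.2.length + portalRank R.2 else 0 }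
          (portalTree L.2) (portalTree R.2)])
      else (s, L.2 ++ R.2)

/-- The top tier: the binary tree that arises from `t` by contracting each micro tree of the
Farzan–Munro decomposition with parameter `B` to a single node. Each node carries its micro tree. -/
def topTier (B : ℕ) (t : BinaryTree Unit) : BinaryTree MicroTree :=
  portalTree (contract (declarePermanent (farzanMunro B t))).2

/-- The list of the values of a binary tree in depth-first order (preorder). -/
def preorder {α : Type*} : BinaryTree α → List α
  | .nil => []
  | .node a l r => a :: (preorder l ++ preorder r)

/-- The shapes of the micro trees `μ₁, …, μₘ` of `t`, in depth-first order of the top tier. -/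
def microShapes (B : ℕ) (t : BinaryTree Unit) : List (BinaryTree Unit) :=
  (preorder (topTier B t)).map MicroTree.shape

/-! ### The hypersuccinct code -/

/-- The hypersuccinct encoding of `t`, with tree covering parameter `B`, and `M + 1` the number of
different portal ranks. Its parts are: the numbers of nodes and of micro trees; the top tier; the
table of the length-restricted Huffman code (the number of entries, and for each shape that occurs
its codeword, preceded by the length of the codeword, and its size and balanced parentheses); the
codewords of the micro trees; the portals of the micro trees. -/
def encode (B M : ℕ) (t : BinaryTree Unit) : List Bool :=
  let T := topTier B t
  let μs := preorder T
  let shapes := microShapes B t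
  let C := lengthRestricted (huffmanCode shapes)
  (eliasGamma t.numNodes ++ eliasGamma μs.length)
    ++ balancedParens T
    ++ (eliasGamma shapes.dedup.length ++ shapes.dedup.flatMap (fun s =>
        eliasGamma (C s).length ++ C s ++ eliasGamma s.numNodes ++ balancedParens s))
    ++ shapes.flatMap C
    ++ μs.flatMap (fun μ => fixedWidth (Nat.clog 2 (M + 1)) μ.leftPortal
        ++ fixedWidth (Nat.clog 2 (M + 1)) μ.rightPortal)

/-- The tree covering parameter `⌈lg n / 8⌉` (and `1` for `n ≤ 1`, since it has to be positive). -/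
noncomputable def coverParam (n : ℕ) : ℕ := max 1 ⌈Real.logb 2 n / 8⌉₊

/-- The bound `⌈lg n / 4⌉` for the sizes of micro trees. -/
noncomputable def microBound (n : ℕ) : ℕ := ⌈Real.logb 2 n / 4⌉₊

/-- The hypersuccinct code `H`. -/
noncomputable def hypersuccinct (t : BinaryTree Unit) : List Bool :=
  encode (coverParam t.numNodes) (microBound t.numNodes) t

/-- `∑ i, |C(μ_i)|`, the total length of the Huffman code for the micro trees of `t`. -/
noncomputable def microTreeCodeLength (t : BinaryTree Unit) : ℕ :=
  let shapes := microShapes (coverParam t.numNodes) t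
  (shapes.map (fun s => (huffmanCode shapes s).length)).sum

end Hypersuccinct

namespace Hypersuccinct

/-! The Huffman code spends at most one bit per letter more than the cross entropy with any
subprobability on the letters (`sum_huffmanCode_le_crossEntropy`). So it suffices to find one
subprobability on shapes under which the product of the masses of the micro trees of `t` is not much
smaller than `P[t]`. The source itself does not serve: micro trees are fringe subtrees with pieces
cut off, and the same shape may occur with different sizes or heights. The subprobability
`heavyMass` is a mixture. With constant weights it generates nodes and null pointers regardless of
the source, and at any moment it may guess a value `k < b` and let the source continue from `k`; the
source then stops at each nonempty position with probability `ε` (`lightMass`), which models a cut.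
Subtrees with fewer than `b` nodes follow the source at full probability. The losses are a factor `ε
/ (2b)` for each cut, `1 - ε` for each node and `1 / (4b)` for each heavy node and each switch to
the source (`IsSource.light_decomposition`, `IsSource.heavy_decomposition`). With `ε = 1 / b` and
`H` heavy nodes the logarithmic loss is `O((m' + H + 1) lg b + n / b)`, where `m'` is the number of
cuts. The Farzan–Munro decomposition has `m' = O(n / β + 1)` (`farzanMunro_marks`). Taking `b = β`
gives the great-branching bound, since `n / β = O(H + 1)`. Taking for `b` the maximum of `2`, `β`
and `⌈B⌉` gives the other two parts: fringe dominance makes `H lg b` sublinear, all other terms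
depend on `n` only and are `o(n)`, and the average case is the expectation of the bound for single
trees. -/

/-! ### Huffman codes versus cross entropy -/

/-- The sum of the weights of the inner nodes of a code tree. -/
def HuffTree.cost {α : Type*} : HuffTree α → ℕ
  | .leaf _ _ => 0
  | .node l r => l.weight + r.weight + l.cost + r.cost

/-- Every leaf of the code tree carries the weight that `f` gives to its symbol. -/
def HuffTree.HasWeights {α : Type*} (f : α → ℕ) : HuffTree α → Prop
  | .leaf w a => w = f a
  | .node l r => l.HasWeights f ∧ r.HasWeights f

/-- The symbols of a code tree. -/
def HuffTree.symbols {α : Type*} : HuffTree α → List α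
  | .leaf _ a => [a]
  | .node l r => l.symbols ++ r.symbols

theorem HuffTree.map_fst_codewords {α : Type*} (T : HuffTree α) :
    T.codewords.map Prod.fst = T.symbols := by
  induction T with
  | leaf w a => rfl
  | node l r hl hr =>
    simp only [codewords, symbols, List.map_append, List.map_map, ← hl, ← hr]
    rfl

theorem HuffTree.sum_weights {α : Type*} {f : α → ℕ} {T : HuffTree α} (h : T.HasWeights f) :
    (T.symbols.map f).sum = T.weight := by
  induction T with
  | leaf w a => simp [symbols, weight, show w = f a from h]
  | node l r hl hr => simp [symbols, weight, hl h.1, hr h.2]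

theorem HuffTree.sum_codewords {α : Type*} {f : α → ℕ} {T : HuffTree α} (h : T.HasWeights f) :
    (T.codewords.map (fun x => f x.1 * x.2.length)).sum = T.cost := by
  induction T with
  | leaf w a => simp [codewords, cost]
  | node l r hl hr =>
    have key : ∀ T : HuffTree α, T.HasWeights f →
        (T.codewords.map (fun x => f x.1)).sum = T.weight := by
      intro T hT
      rw [← HuffTree.sum_weights hT, ← HuffTree.map_fst_codewords, List.map_map]
      rfl
    simp only [codewords, List.map_append, List.map_map, List.sum_append, cost, Function.comp_def,
      List.length_cons, Nat.mul_add, Nat.mul_one, List.sum_map_add, key l h.1, key r h.2,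
      hl h.1, hr h.2]
    ring

theorem insertByWeight_perm {α : Type*} (a : HuffTree α) (l : List (HuffTree α)) :
    (insertByWeight a l).Perm (a :: l) := by
  induction l with
  | nil => exact List.Perm.refl _
  | cons b l ih =>
    unfold insertByWeight
    split
    · exact List.Perm.refl _
    · exact (ih.cons b).trans (List.Perm.swap a b l)

theorem insertByWeight_pairwise {α : Type*} (a : HuffTree α) {l : List (HuffTree α)}
    (h : l.Pairwise (fun x y => x.weight ≤ y.weight)) :
    (insertByWeight a l).Pairwise (fun x y => x.weight ≤ y.weight) := by
  induction l with
  | nil => simp [insertByWeight]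
  | cons b l ih =>
    rw [List.pairwise_cons] at h
    unfold insertByWeight
    split
    · rename_i hab
      refine List.pairwise_cons.2 ⟨fun x hx => ?_, List.pairwise_cons.2 h⟩
      rcases List.mem_cons.1 hx with rfl | hx
      · exact hab
      · exact hab.trans (h.1 x hx)
    · rename_i hab
      refine List.pairwise_cons.2 ⟨fun x hx => ?_, ih h.2⟩
      rcases List.mem_cons.1 ((insertByWeight_perm a l).mem_iff.1 hx) with rfl | hx
      · omega
      · exact h.1 x hx

/-- The function `w ↦ w lg w`. -/
noncomputable def mulLog (w : ℝ) : ℝ := w * Real.logb 2 w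

/-- Since `2a ≤ a + b`, the factor `lg` of `a` grows by at least `1`; for `b`, concavity gives `lg
(1 + x) ≥ x` on `[0, 1]` with `x = a / b`. Each contributes `a`. -/
theorem mulLog_add {a b : ℝ} (ha : 0 < a) (hab : a ≤ b) :
    mulLog a + mulLog b + 2 * a ≤ mulLog (a + b) := by
  have hb : 0 < b := ha.trans_le hab
  have h2 : (0 : ℝ) < Real.log 2 := Real.log_pos one_lt_two
  have h1 : Real.logb 2 a + 1 ≤ Real.logb 2 (a + b) := by
    have : Real.logb 2 (2 * a) ≤ Real.logb 2 (a + b) :=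
      Real.logb_le_logb_of_le one_lt_two (by positivity) (by linarith)
    rw [Real.logb_mul two_ne_zero ha.ne', Real.logb_self_eq_one one_lt_two] at this
    linarith
  have h3 : b * Real.logb 2 b + a ≤ b * Real.logb 2 (a + b) := by
    have hx0 : 0 ≤ a / b := by positivity
    have hx1 : a / b ≤ 1 := (div_le_one hb).2 hab
    have hconc := strictConcaveOn_log_Ioi.concaveOn.2 (show (1 : ℝ) ∈ Set.Ioi 0 by simp)
      (show (2 : ℝ) ∈ Set.Ioi 0 by simp) (show 0 ≤ 1 - a / b by linarith) hx0 (by ring)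
    simp only [smul_eq_mul, Real.log_one, mul_zero, zero_add, mul_one] at hconc
    have h4 : Real.log (1 - a / b + a / b * 2) = Real.log (a + b) - Real.log b := by
      rw [← Real.log_div (by positivity) hb.ne']
      congr 1
      field_simp
      ring
    rw [h4] at hconc
    have h5 : a / b ≤ Real.logb 2 (a + b) - Real.logb 2 b := by
      rw [Real.logb, Real.logb, ← sub_div, le_div_iff₀ h2]
      exact hconc
    have h6 := mul_le_mul_of_nonneg_left h5 hb.le
    rw [mul_div_cancel₀ _ hb.ne'] at h6
    linarith
  have h7 := mul_le_mul_of_nonneg_left h1 ha.le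
  unfold mulLog
  nlinarith

/-- Amortized analysis of the merging. A merge of weights `a ≤ b` costs `a + b`, but `mulLog_add`
only repays `2a`. The missing `b - a` comes from the term `-δ`: the minimal weight rises from `a` to
at least `b`, since all remaining trees weigh at least `b`. -/
theorem huffmanMerge_spec {α : Type*} (f : α → ℕ) : ∀ (k : ℕ) (F : List (HuffTree α)),
    F.length = k + 1 → F.Pairwise (fun x y => x.weight ≤ y.weight) →
    (∀ x ∈ F, 0 < x.weight) → (∀ x ∈ F, x.HasWeights f) →
    ∃ T, huffmanMerge F = some T ∧ T.HasWeights f ∧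
      T.symbols.Perm (F.flatMap HuffTree.symbols) ∧
      ∀ δ : ℕ, (∀ x ∈ F, δ ≤ x.weight) →
        (T.cost : ℝ) ≤ (F.map (fun x => (x.cost : ℝ) - mulLog x.weight)).sum
          + mulLog (F.map HuffTree.weight).sum + (F.map HuffTree.weight).sum - δ := by
  intro k
  induction k with
  | zero =>
    intro F hF _ _ hw
    obtain ⟨a, rfl⟩ := List.length_eq_one_iff.1 hF
    refine ⟨a, by simp [huffmanMerge], hw a (by simp), by simp, fun δ hδ => ?_⟩
    have : (δ : ℝ) ≤ a.weight := by exact_mod_cast hδ a (by simp)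
    simp only [List.map_cons, List.map_nil, List.sum_cons, List.sum_nil, add_zero]
    linarith
  | succ k ih =>
    intro F hF hs hpos hw
    match F, hF, hs, hpos, hw with
    | a :: b :: l, hF, hs, hpos, hw =>
      have hperm := insertByWeight_perm (HuffTree.node a b) l
      rw [List.pairwise_cons, List.pairwise_cons] at hs
      have ha := hpos a (by simp)
      have hab := hs.1 b (by simp)
      obtain ⟨T, hT, hTw, hTs, hTc⟩ := ih (insertByWeight (.node a b) l)
        (by simpa [length_insertByWeight] using hF)
        (insertByWeight_pairwise _ hs.2.2)
        (by
          intro x hx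
          rcases List.mem_cons.1 (hperm.mem_iff.1 hx) with rfl | hx
          · simp only [HuffTree.weight]; omega
          · exact hpos x (by simp [hx]))
        (by
          intro x hx
          rcases List.mem_cons.1 (hperm.mem_iff.1 hx) with rfl | hx
          · exact ⟨hw a (by simp), hw b (by simp)⟩
          · exact hw x (by simp [hx]))
      refine ⟨T, by rw [huffmanMerge, hT], hTw, ?_, fun δ hδ => ?_⟩
      · refine hTs.trans ((hperm.flatMap_right _).trans ?_)
        simp only [List.flatMap_cons, HuffTree.symbols, List.append_assoc]
        exact List.Perm.refl _
      -- The induction hypothesis is used with `δ` equal to the second smallest weight, a lower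
      -- bound for all weights after the merge.
      · have h1 := hTc b.weight (by
          intro x hx
          rcases List.mem_cons.1 (hperm.mem_iff.1 hx) with rfl | hx
          · simp [HuffTree.weight]
          · exact hs.2.1 x hx)
        rw [(hperm.map _).sum_eq, (hperm.map HuffTree.weight).sum_eq] at h1
        have hδa : (δ : ℝ) ≤ a.weight := by exact_mod_cast hδ a (by simp)
        have h2 := mulLog_add (a := a.weight) (b := b.weight) (by exact_mod_cast ha)
          (by exact_mod_cast hab)
        simp only [List.map_cons, List.sum_cons, HuffTree.weight, HuffTree.cost, Nat.cast_add]
          at h1 ⊢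
        rw [← add_assoc (a.weight : ℝ)]
        linarith

theorem lookup_eq_of_mem {α β : Type*} [DecidableEq α] {l : List (α × β)}
    (h : (l.map Prod.fst).Nodup) {x : α × β} (hx : x ∈ l) : l.lookup x.1 = some x.2 := by
  induction l with
  | nil => simp at hx
  | cons y l ih =>
    rw [List.map_cons, List.nodup_cons] at h
    rcases List.mem_cons.1 hx with rfl | hx'
    · obtain ⟨x1, x2⟩ := x
      rw [List.lookup_cons]
      simp
    · have hne : (x.1 == y.1) = false := by
        rw [beq_eq_false_iff_ne]
        rintro he
        exact h.1 (he ▸ List.mem_map_of_mem (f := Prod.fst) hx')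
      obtain ⟨y1, y2⟩ := y
      rw [List.lookup_cons, hne]
      exact ih h.2 hx'

/-- The right-hand side is `m` bits plus `m` times the empirical entropy: `huffmanMerge_spec` with
`δ = 0`, started from single leaves. -/
theorem sum_huffmanCode_le {α : Type*} [DecidableEq α] (s : List α) (hs : s ≠ []) :
    ((s.map (fun a => (huffmanCode s a).length)).sum : ℝ)
      ≤ s.length + mulLog s.length - ∑ a ∈ s.toFinset, mulLog (s.count a) := by
  set L := s.dedup.map (fun b => HuffTree.leaf (s.count b) b) with hL
  have hLF : ∀ L : List (HuffTree α), (L.foldr insertByWeight []).Perm L ∧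
      (L.foldr insertByWeight []).Pairwise (fun x y => x.weight ≤ y.weight) := by
    intro L
    induction L with
    | nil => simp
    | cons a L ih =>
      exact ⟨(insertByWeight_perm a _).trans (ih.1.cons a), insertByWeight_pairwise a ih.2⟩
  obtain ⟨hperm, hsort⟩ := hLF L
  have hlen : (L.foldr insertByWeight []).length = (s.dedup.length - 1) + 1 := by
    rw [hperm.length_eq, hL, List.length_map]
    have : s.dedup ≠ [] := by simpa using hs
    have := List.length_pos_iff.2 this
    omega
  obtain ⟨T, hT, hTw, hTs, hTc⟩ := huffmanMerge_spec (fun a => s.count a) _ _ hlen hsort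
    (by
      intro x hx
      obtain ⟨b, hb, rfl⟩ := List.mem_map.1 (hperm.mem_iff.1 hx)
      exact List.count_pos_iff.2 (List.mem_dedup.1 hb))
    (by
      intro x hx
      obtain ⟨b, hb, rfl⟩ := List.mem_map.1 (hperm.mem_iff.1 hx)
      rfl)
  have hsym : T.symbols.Perm s.dedup := by
    refine hTs.trans ((hperm.flatMap_right _).trans ?_)
    rw [hL, List.flatMap_map]
    simp [HuffTree.symbols]
  have hsumc : (s.dedup.map (fun a => s.count a)).sum = s.length := by
    simpa [Finset.sum] using s.sum_toFinset_count_eq_length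
  have h1 : (s.map (fun a => (huffmanCode s a).length)).sum = T.cost := by
    rw [← HuffTree.sum_codewords hTw, Finset.sum_list_map_count]
    have : ∑ a ∈ s.toFinset, s.count a • (huffmanCode s a).length
        = (s.dedup.map (fun a => s.count a * (huffmanCode s a).length)).sum := by
      simp [Finset.sum]
    rw [this, ← (hsym.map _).sum_eq, ← HuffTree.map_fst_codewords, List.map_map]
    congr 1
    apply List.map_congr_left
    intro x hx
    have hnd : (T.codewords.map Prod.fst).Nodup := by
      rw [HuffTree.map_fst_codewords]
      exact hsym.nodup_iff.2 s.nodup_dedup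
    have : huffmanCode s x.1 = x.2 := by
      unfold huffmanCode
      rw [← hL, hT]
      simp [lookup_eq_of_mem hnd hx]
    simp [this]
  have h2 := hTc 0 (by simp)
  rw [(hperm.map _).sum_eq, (hperm.map HuffTree.weight).sum_eq, hL, List.map_map, List.map_map,
    show HuffTree.weight ∘ (fun b => HuffTree.leaf (s.count b) b) = fun a : α => s.count a from rfl,
    hsumc] at h2
  have h3 : (s.dedup.map ((fun x => (x.cost : ℝ) - mulLog x.weight) ∘
      (fun b => HuffTree.leaf (s.count b) b))).sum = - ∑ a ∈ s.toFinset, mulLog (s.count a) := by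
    rw [← Finset.sum_neg_distrib]
    simp [Finset.sum, Function.comp_def, HuffTree.cost, HuffTree.weight]
  rw [h3] at h2
  rw [h1]
  simp only [Nat.cast_zero, sub_zero] at h2
  linarith

/-- Gibbs' inequality, from `log x ≤ x - 1` at `x = m q(a) / count(a)`; total mass at most `1` is
enough. -/
theorem sum_huffmanCode_le_crossEntropy {α : Type*} [DecidableEq α] (s : List α) (q : α → ℝ)
    (hq : ∀ a ∈ s, 0 < q a) (hsum : ∑ a ∈ s.toFinset, q a ≤ 1) :
    ((s.map (fun a => (huffmanCode s a).length)).sum : ℝ)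
      ≤ s.length - (s.map (fun a => Real.logb 2 (q a))).sum := by
  rcases eq_or_ne s [] with rfl | hs
  · simp
  refine (sum_huffmanCode_le s hs).trans ?_
  have h2 : (0 : ℝ) < Real.log 2 := Real.log_pos one_lt_two
  have hm : (0 : ℝ) < s.length := by exact_mod_cast List.length_pos_iff.2 hs
  have hcount : (∑ a ∈ s.toFinset, (s.count a : ℝ)) = s.length := by
    exact_mod_cast s.sum_toFinset_count_eq_length
  have key : ∀ a ∈ s.toFinset, s.count a • Real.logb 2 (q a) ≤
      mulLog (s.count a) - s.count a * Real.logb 2 s.length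
        + (s.length * q a - s.count a) / Real.log 2 := by
    intro a ha
    have ha := List.mem_toFinset.1 ha
    have hk : (0 : ℝ) < s.count a := by exact_mod_cast List.count_pos_iff.2 ha
    have hqa := hq a ha
    have h := Real.log_le_sub_one_of_pos (x := s.length * q a / s.count a) (by positivity)
    rw [Real.log_div (by positivity) hk.ne', Real.log_mul hm.ne' hqa.ne'] at h
    have h3 := mul_le_mul_of_nonneg_left h hk.le
    rw [mul_sub _ (_ / _), mul_one, mul_div_cancel₀ _ hk.ne'] at h3
    unfold mulLog Real.logb
    rw [nsmul_eq_mul, ← sub_nonneg]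
    have : (s.count a : ℝ) * (Real.log (s.count a) / Real.log 2)
        - s.count a * (Real.log s.length / Real.log 2)
        + (s.length * q a - s.count a) / Real.log 2 - s.count a * (Real.log (q a) / Real.log 2)
        = ((s.length * q a - s.count a)
          - s.count a * (Real.log s.length + Real.log (q a) - Real.log (s.count a)))
            / Real.log 2 := by
      ring
    rw [this]
    exact div_nonneg (by linarith) h2.le
  have h := Finset.sum_le_sum key
  rw [Finset.sum_add_distrib, Finset.sum_sub_distrib, ← Finset.sum_mul, ← Finset.sum_div,
    Finset.sum_sub_distrib, ← Finset.mul_sum, hcount] at h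
  rw [Finset.sum_list_map_count]
  have h4 : (s.length * ∑ a ∈ s.toFinset, q a - s.length) / Real.log 2 ≤ 0 :=
    div_nonpos_of_nonpos_of_nonneg (by nlinarith) h2.le
  have h5 : mulLog s.length = s.length * Real.logb 2 s.length := rfl
  linarith

/-! ### Tree sources that split a size parameter -/

/-- The statistic of binary trees that is `0` on the empty tree and combines by `c` at a node. -/
def treeParam (c : ℕ → ℕ → ℕ) : BinaryTree Unit → ℕ
  | .nil => 0
  | .node _ l r => c (treeParam c l) (treeParam c r)

/-- The probability of a tree under the source `p` that depends on the statistic given by `c`. -/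
def sourceProb (c : ℕ → ℕ → ℕ) (p : ℕ → ℕ → ℝ) : BinaryTree Unit → ℝ
  | .nil => 1
  | .node _ l r => p (treeParam c l) (treeParam c r) * sourceProb c p l * sourceProb c p r

/-- The pairs of values that combine to `k`. -/
def splits (c : ℕ → ℕ → ℕ) (k : ℕ) : Finset (ℕ × ℕ) :=
  (Finset.range k ×ˢ Finset.range k).filter (fun ij => c ij.1 ij.2 = k)

/-- `p` is a source with respect to the statistic given by `c`. -/
structure IsSource (c : ℕ → ℕ → ℕ) (p : ℕ → ℕ → ℝ) : Prop where
  left_lt : ∀ i j, i < c i j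
  right_lt : ∀ i j, j < c i j
  le_add : ∀ i j, c i j ≤ i + j + 1
  nonneg : ∀ i j, 0 ≤ p i j
  le_one : ∀ i j, p i j ≤ 1
  sum_le_one : ∀ k, ∑ ij ∈ splits c k, p ij.1 ij.2 ≤ 1

theorem IsFixedSizeSource.isSource {p : ℕ → ℕ → ℝ} (h : IsFixedSizeSource p) :
    IsSource (fun i j => i + j + 1) p where
  left_lt i j := by omega
  right_lt i j := by omega
  le_add i j := le_rfl
  nonneg := h.nonneg
  le_one := h.le_one
  sum_le_one k := by
    rcases k with _ | k
    · simp [splits]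
    · rw [← h.sum_eq_one k, ← Finset.Nat.sum_antidiagonal_eq_sum_range_succ p]
      refine (Finset.sum_congr ?_ fun _ _ => rfl).le
      ext ⟨i, j⟩
      simp only [splits, Finset.mem_filter, Finset.mem_product, Finset.mem_range]
      rw [Finset.HasAntidiagonal.mem_antidiagonal]
      omega

theorem IsFixedHeightSource.isSource {p : ℕ → ℕ → ℝ} (h : IsFixedHeightSource p) :
    IsSource (fun i j => max i j + 1) p where
  left_lt i j := by omega
  right_lt i j := by omega
  le_add i j := by omega
  nonneg := h.nonneg
  le_one := h.le_one
  sum_le_one k := by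
    rcases k with _ | k
    · simp [splits]
    · rw [← h.sum_eq_one k]
      refine (Finset.sum_congr ?_ fun _ _ => rfl).le
      ext ⟨i, j⟩
      simp only [splits, Finset.mem_filter, Finset.mem_product, Finset.mem_range]
      omega

theorem treeParam_size (t : BinaryTree Unit) :
    treeParam (fun i j => i + j + 1) t = t.numNodes := by
  induction t with
  | nil => rfl
  | node a l r hl hr => simp [treeParam, hl, hr]

theorem treeParam_height (t : BinaryTree Unit) :
    treeParam (fun i j => max i j + 1) t = t.height := by
  induction t with
  | nil => rfl
  | node a l r hl hr => simp [treeParam, hl, hr]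

theorem sourceProb_size (p : ℕ → ℕ → ℝ) :
    sourceProb (fun i j => i + j + 1) p = fixedSizeProb p := by
  funext t
  induction t with
  | nil => rfl
  | node a l r hl hr => simp [sourceProb, fixedSizeProb, hl, hr, treeParam_size]

theorem sourceProb_height (p : ℕ → ℕ → ℝ) :
    sourceProb (fun i j => max i j + 1) p = fixedHeightProb p := by
  funext t
  induction t with
  | nil => rfl
  | node a l r hl hr => simp [sourceProb, fixedHeightProb, hl, hr, treeParam_height]

/-! ### Subprobabilities on the shapes of micro trees -/

section Source

variable {c : ℕ → ℕ → ℕ} {p : ℕ → ℕ → ℝ}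

/-- Hence subtrees with fewer than `b` nodes have one of the values `k < b` that `heavyMass` can
guess, for size and height alike. -/
theorem IsSource.treeParam_le (h : IsSource c p) (t : BinaryTree Unit) :
    treeParam c t ≤ t.numNodes := by
  induction t with
  | nil => rfl
  | node a l r hl hr =>
    have := h.le_add (treeParam c l) (treeParam c r)
    simp only [treeParam, BinaryTree.numNodes]
    omega

theorem IsSource.sourceProb_nonneg (h : IsSource c p) (t : BinaryTree Unit) :
    0 ≤ sourceProb c p t := by
  induction t with
  | nil => exact zero_le_one
  | node a l r hl hr => exact mul_nonneg (mul_nonneg (h.nonneg _ _) hl) hr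

/-- A finite set containing all binary trees of height at most `N`. -/
def treesOfHeightLE : ℕ → Finset (BinaryTree Unit)
  | 0 => {.nil}
  | N + 1 => insert .nil ((treesOfHeightLE N ×ˢ treesOfHeightLE N).image
      (fun x => .node () x.1 x.2))

theorem mem_treesOfHeightLE {N : ℕ} {t : BinaryTree Unit} (h : t.height ≤ N) :
    t ∈ treesOfHeightLE N := by
  induction N generalizing t with
  | zero =>
    cases t with
    | nil => simp [treesOfHeightLE]
    | node a l r => simp at h
  | succ N ih =>
    cases t with
    | nil => simp [treesOfHeightLE]
    | node a l r =>
      simp only [BinaryTree.height, Nat.add_le_add_iff_right, sup_le_iff] at h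
      simp [treesOfHeightLE, ih h.1, ih h.2]

theorem sum_treesOfHeightLE_succ (f : BinaryTree Unit → ℝ) (N : ℕ) :
    ∑ t ∈ treesOfHeightLE (N + 1), f t = f .nil +
      ∑ l ∈ treesOfHeightLE N, ∑ r ∈ treesOfHeightLE N, f (.node () l r) := by
  rw [treesOfHeightLE, Finset.sum_insert (by simp), Finset.sum_image, Finset.sum_product]
  rintro ⟨a, b⟩ _ ⟨a', b'⟩ _ h
  simpa using h

/-- The probability that the source, started with the value `k` and stopping at each node with
probability `ε`, generates the given shape. -/
noncomputable def lightMass (c : ℕ → ℕ → ℕ) (p : ℕ → ℕ → ℝ) (ε : ℝ) : BinaryTree Unit → ℕ → ℝ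
  | .nil, k => if k = 0 then 1 else ε
  | .node _ l r, k => (1 - ε) * ∑ ij ∈ splits c k,
      p ij.1 ij.2 * lightMass c p ε l ij.1 * lightMass c p ε r ij.2

theorem IsSource.lightMass_nonneg (h : IsSource c p) {ε : ℝ} (h0 : 0 ≤ ε) (h1 : ε ≤ 1)
    (t : BinaryTree Unit) (k : ℕ) : 0 ≤ lightMass c p ε t k := by
  induction t generalizing k with
  | nil =>
    unfold lightMass
    split
    · exact zero_le_one
    · exact h0
  | node a l r hl hr =>
    exact mul_nonneg (by linarith) (Finset.sum_nonneg fun ij _ =>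
      mul_nonneg (mul_nonneg (h.nonneg _ _) (hl _)) (hr _))

/-- At a value `k ≠ 0` the process stops with mass `ε` and continues with mass at most `1 - ε`; at
`k = 0` there are no splits and the empty shape has all the mass. -/
theorem IsSource.sum_lightMass_le_one (h : IsSource c p) {ε : ℝ} (h0 : 0 ≤ ε) (h1 : ε ≤ 1)
    (N k : ℕ) : ∑ t ∈ treesOfHeightLE N, lightMass c p ε t k ≤ 1 := by
  induction N generalizing k with
  | zero =>
    simp only [treesOfHeightLE, Finset.sum_singleton, lightMass]
    split
    · exact le_rfl
    · exact h1
  | succ N ih =>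
    rw [sum_treesOfHeightLE_succ]
    simp only [lightMass]
    have h2 : ∑ l ∈ treesOfHeightLE N, ∑ r ∈ treesOfHeightLE N, ((1 - ε) * ∑ ij ∈ splits c k,
        p ij.1 ij.2 * lightMass c p ε l ij.1 * lightMass c p ε r ij.2)
        = (1 - ε) * ∑ ij ∈ splits c k, p ij.1 ij.2 * ((∑ l ∈ treesOfHeightLE N,
          lightMass c p ε l ij.1) * ∑ r ∈ treesOfHeightLE N, lightMass c p ε r ij.2) := by
      simp only [← Finset.mul_sum]
      congr 1
      simp only [Finset.sum_mul_sum]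
      simp only [Finset.mul_sum]
      rw [Finset.sum_comm (s := splits c k)]
      refine Finset.sum_congr rfl fun l _ => ?_
      rw [Finset.sum_comm (s := splits c k)]
      exact Finset.sum_congr rfl fun r _ => Finset.sum_congr rfl fun ij _ => mul_assoc _ _ _
    rw [h2]
    have h3 : ∑ ij ∈ splits c k, p ij.1 ij.2 * ((∑ l ∈ treesOfHeightLE N,
          lightMass c p ε l ij.1) * ∑ r ∈ treesOfHeightLE N, lightMass c p ε r ij.2)
        ≤ ∑ ij ∈ splits c k, p ij.1 ij.2 := by
      refine Finset.sum_le_sum fun ij _ => mul_le_of_le_one_right (h.nonneg _ _) ?_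
      exact mul_le_one₀ (ih _) (Finset.sum_nonneg fun t _ => h.lightMass_nonneg h0 h1 t _) (ih _)
    split
    · rename_i hk
      simp [splits, hk]
    · have := h3.trans (h.sum_le_one k)
      nlinarith

/-- A subprobability on shapes: nodes are generated one by one, until at a node or null pointer the
source takes over, with an explicitly given value below `b`. -/
noncomputable def heavyMass (c : ℕ → ℕ → ℕ) (p : ℕ → ℕ → ℝ) (ε : ℝ) (b : ℕ) : BinaryTree Unit → ℝ
  | .nil => 1 / 4 + 1 / (2 * b) * ∑ k ∈ Finset.range b, lightMass c p ε .nil k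
  | .node a l r => 1 / 4 * heavyMass c p ε b l * heavyMass c p ε b r
      + 1 / (2 * b) * ∑ k ∈ Finset.range b, lightMass c p ε (.node a l r) k

theorem IsSource.heavyMass_nonneg (h : IsSource c p) {ε : ℝ} (h0 : 0 ≤ ε) (h1 : ε ≤ 1) (b : ℕ)
    (t : BinaryTree Unit) : 0 ≤ heavyMass c p ε b t := by
  have h2 : ∀ t, 0 ≤ 1 / (2 * (b : ℝ)) * ∑ k ∈ Finset.range b, lightMass c p ε t k := fun t =>
    mul_nonneg (by positivity) (Finset.sum_nonneg fun k _ => h.lightMass_nonneg h0 h1 t k)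
  induction t with
  | nil => exact add_nonneg (by norm_num) (h2 _)
  | node a l r hl hr => exact add_nonneg (by positivity) (h2 _)

theorem IsSource.heavyMass_ge_lightMass (h : IsSource c p) {ε : ℝ} (h0 : 0 ≤ ε) (h1 : ε ≤ 1)
    {b k : ℕ} (hk : k < b) (t : BinaryTree Unit) :
    1 / (2 * b) * lightMass c p ε t k ≤ heavyMass c p ε b t := by
  have h2 : 1 / (2 * b) * lightMass c p ε t k
      ≤ 1 / (2 * b) * ∑ k ∈ Finset.range b, lightMass c p ε t k :=
    mul_le_mul_of_nonneg_left (Finset.single_le_sum (f := fun k => lightMass c p ε t k)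
      (fun k _ => h.lightMass_nonneg h0 h1 t k) (Finset.mem_range.2 hk)) (by positivity)
  cases t with
  | nil =>
    rw [heavyMass]
    linarith
  | node a l r =>
    have h3 := h.heavyMass_nonneg h0 h1 b l
    have h4 := h.heavyMass_nonneg h0 h1 b r
    have : 0 ≤ 1 / 4 * heavyMass c p ε b l * heavyMass c p ε b r := by positivity
    rw [heavyMass]
    linarith

theorem IsSource.heavyMass_node_ge (h : IsSource c p) {ε : ℝ} (h0 : 0 ≤ ε) (h1 : ε ≤ 1)
    (b : ℕ) (l r : BinaryTree Unit) :
    1 / 4 * heavyMass c p ε b l * heavyMass c p ε b r ≤ heavyMass c p ε b (.node () l r) := by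
  have h2 : 0 ≤ 1 / (2 * (b : ℝ)) * ∑ k ∈ Finset.range b, lightMass c p ε (.node () l r) k :=
    mul_nonneg (by positivity) (Finset.sum_nonneg fun k _ => h.lightMass_nonneg h0 h1 _ k)
  rw [heavyMass]
  linarith

theorem IsSource.heavyMass_nil_ge (h : IsSource c p) {ε : ℝ} (h0 : 0 ≤ ε) (h1 : ε ≤ 1)
    (b : ℕ) : 1 / 4 ≤ heavyMass c p ε b .nil := by
  have h2 : 0 ≤ 1 / (2 * (b : ℝ)) * ∑ k ∈ Finset.range b, lightMass c p ε .nil k :=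
    mul_nonneg (by positivity) (Finset.sum_nonneg fun k _ => h.lightMass_nonneg h0 h1 _ k)
  rw [heavyMass]
  linarith

/-- The total `S` up to a given height satisfies `S' ≤ 1/4 + S² / 4 + 1/2` when the height grows by
one, and `1` is a fixed point of this recursion. The `1/2` bounds all switches to the source. -/
theorem IsSource.sum_treesOfHeightLE_heavyMass_le_one (h : IsSource c p) {ε : ℝ} (h0 : 0 ≤ ε)
    (h1 : ε ≤ 1) (b N : ℕ) : ∑ t ∈ treesOfHeightLE N, heavyMass c p ε b t ≤ 1 := by
  have hlight : ∀ N, ∑ t ∈ treesOfHeightLE N,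
      1 / (2 * (b : ℝ)) * ∑ k ∈ Finset.range b, lightMass c p ε t k ≤ 1 / 2 := by
    intro N
    rw [← Finset.mul_sum, Finset.sum_comm]
    have h2 : ∑ k ∈ Finset.range b, ∑ t ∈ treesOfHeightLE N, lightMass c p ε t k ≤ b := by
      refine (Finset.sum_le_sum fun k _ => h.sum_lightMass_le_one h0 h1 N k).trans ?_
      simp
    refine (mul_le_mul_of_nonneg_left h2 (by positivity)).trans ?_
    rcases eq_or_ne b 0 with rfl | hb
    · simp
    · have : (b : ℝ) ≠ 0 := by exact_mod_cast hb
      refine le_of_eq ?_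
      field_simp
  induction N with
  | zero =>
    have := hlight 0
    simp only [treesOfHeightLE, Finset.sum_singleton, heavyMass] at this ⊢
    linarith
  | succ N ih =>
    have h3 := hlight (N + 1)
    rw [sum_treesOfHeightLE_succ] at h3 ⊢
    simp only [heavyMass, Finset.sum_add_distrib]
    have h4 : ∑ l ∈ treesOfHeightLE N, ∑ r ∈ treesOfHeightLE N,
        1 / 4 * heavyMass c p ε b l * heavyMass c p ε b r
        = 1 / 4 * ((∑ l ∈ treesOfHeightLE N, heavyMass c p ε b l)
          * ∑ r ∈ treesOfHeightLE N, heavyMass c p ε b r) := by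
      rw [Finset.sum_mul_sum]
      simp only [Finset.mul_sum, mul_assoc]
    have h5 := mul_le_one₀ ih (Finset.sum_nonneg fun t _ => h.heavyMass_nonneg h0 h1 b t) ih
    rw [h4]
    linarith

theorem IsSource.sum_heavyMass_le_one (h : IsSource c p) {ε : ℝ} (h0 : 0 ≤ ε)
    (h1 : ε ≤ 1) (b : ℕ) (F : Finset (BinaryTree Unit)) : ∑ t ∈ F, heavyMass c p ε b t ≤ 1 :=
  (Finset.sum_le_sum_of_subset_of_nonneg
    (fun _ ht => mem_treesOfHeightLE (Finset.le_sup (f := BinaryTree.height) ht))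
    (fun t _ _ => h.heavyMass_nonneg h0 h1 b t)).trans
    (h.sum_treesOfHeightLE_heavyMass_le_one h0 h1 b (F.sup BinaryTree.height))

theorem IsSource.heavyMass_le_one (h : IsSource c p) {ε : ℝ} (h0 : 0 ≤ ε)
    (h1 : ε ≤ 1) (b : ℕ) (t : BinaryTree Unit) : heavyMass c p ε b t ≤ 1 := by
  simpa using h.sum_heavyMass_le_one h0 h1 b {t}

end Source

/-! ### The probability of a decomposed tree -/

/-- The number of marked nodes. -/
def numMarks : BinaryTree Bool → ℕ
  | .nil => 0
  | .node c l r => (if c then 1 else 0) + numMarks l + numMarks r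

/-- The product of the masses of the micro trees. -/
def tierMass (Q : BinaryTree Unit → ℝ) (T : BinaryTree MicroTree) : ℝ :=
  ((preorder T).map (fun μ => Q μ.shape)).prod

theorem tierMass_nil (Q : BinaryTree Unit → ℝ) : tierMass Q .nil = 1 := rfl

theorem tierMass_node (Q : BinaryTree Unit → ℝ) (μ : MicroTree) (l r : BinaryTree MicroTree) :
    tierMass Q (.node μ l r) = Q μ.shape * (tierMass Q l * tierMass Q r) := by
  simp [tierMass, preorder]

section Mass

variable {Q : BinaryTree Unit → ℝ} (h0 : ∀ s, 0 ≤ Q s) (h1 : ∀ s, Q s ≤ 1)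
include h0

theorem tierMass_nonneg (T : BinaryTree MicroTree) : 0 ≤ tierMass Q T := by
  induction T with
  | nil => exact zero_le_one
  | node μ l r hl hr =>
    rw [tierMass_node]
    exact mul_nonneg (h0 _) (mul_nonneg hl hr)

theorem prod_tierMass_nonneg (L : List (BinaryTree MicroTree)) :
    0 ≤ (L.map (tierMass Q)).prod :=
  List.prod_nonneg fun x hx => by
    obtain ⟨T, _, rfl⟩ := List.mem_map.1 hx
    exact tierMass_nonneg h0 T

include h1

theorem tierMass_le_one (T : BinaryTree MicroTree) : tierMass Q T ≤ 1 := by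
  induction T with
  | nil => exact le_rfl
  | node μ l r hl hr =>
    rw [tierMass_node]
    have h2 := tierMass_nonneg h0 l
    have h3 := tierMass_nonneg h0 r
    exact mul_le_one₀ (h1 _) (by positivity) (mul_le_one₀ hl h3 hr)

theorem prod_tierMass_le_one (L : List (BinaryTree MicroTree)) :
    (L.map (tierMass Q)).prod ≤ 1 := by
  induction L with
  | nil => simp
  | cons T L ih =>
    rw [List.map_cons, List.prod_cons]
    exact mul_le_one₀ (tierMass_le_one h0 h1 T) (prod_tierMass_nonneg h0 L) ih

/-- `portalTree` keeps only the first nonempty tree. As masses are at most `1`, discarding the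
others can only increase the product, so the uniqueness of the portal on each side of a micro tree
is not needed here. -/
theorem prod_tierMass_le_portalTree (L : List (BinaryTree MicroTree)) :
    (L.map (tierMass Q)).prod ≤ tierMass Q (portalTree L) := by
  induction L with
  | nil => simp [portalTree, tierMass_nil]
  | cons T L ih =>
    rw [List.map_cons, List.prod_cons]
    cases T with
    | nil => simpa [portalTree, isNonempty, tierMass_nil] using ih
    | node μ l r =>
      have : portalTree (.node μ l r :: L) = .node μ l r := rfl
      rw [this]
      exact mul_le_of_le_one_right (tierMass_nonneg h0 _) (prod_tierMass_le_one h0 h1 L)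

end Mass

/-- The tree without its marks. -/
def unmark : BinaryTree Bool → BinaryTree Unit
  | .nil => .nil
  | .node _ l r => .node () (unmark l) (unmark r)

theorem contract_node_false (l r : BinaryTree Bool) : contract (.node false l r)
    = (.node () (contract l).1 (contract r).1, (contract l).2 ++ (contract r).2) := rfl

theorem exists_contract_node_true (l r : BinaryTree Bool) : ∃ μ : MicroTree,
    μ.shape = .node () (contract l).1 (contract r).1 ∧ contract (.node true l r)
      = (.nil, [.node μ (portalTree (contract l).2) (portalTree (contract r).2)]) :=
  ⟨_, rfl, rfl⟩

/-! ### Lower bounds for the product of the masses of the micro trees -/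

section Source

variable {c : ℕ → ℕ → ℕ} {p : ℕ → ℕ → ℝ} {ε : ℝ} {b : ℕ}

theorem IsSource.lightMass_node_ge (h : IsSource c p) (h0 : 0 ≤ ε) (h1 : ε ≤ 1)
    (l r : BinaryTree Unit) (i j : ℕ) :
    (1 - ε) * (p i j * lightMass c p ε l i * lightMass c p ε r j)
      ≤ lightMass c p ε (.node () l r) (c i j) := by
  have hmem : (i, j) ∈ splits c (c i j) := by
    simp [splits, h.left_lt, h.right_lt]
  rw [lightMass]
  refine mul_le_mul_of_nonneg_left ?_ (by linarith)
  exact Finset.single_le_sum (f := fun ij : ℕ × ℕ =>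
    p ij.1 ij.2 * lightMass c p ε l ij.1 * lightMass c p ε r ij.2)
    (fun ij _ => mul_nonneg (mul_nonneg (h.nonneg _ _) (h.lightMass_nonneg h0 h1 _ _))
      (h.lightMass_nonneg h0 h1 _ _)) hmem

/-- In a light subtree every node follows the source. At a cut, the upper component sees a null
pointer at a possibly positive value, of mass at least `ε`, and the lower component guesses its own
value with weight `1 / (2b)`. -/
theorem IsSource.light_decomposition (h : IsSource c p) (h0 : 0 ≤ ε) (h1 : ε ≤ 1)
    (u : BinaryTree Bool) (hu : (unmark u).numNodes < b) :
    sourceProb c p (unmark u) * (ε / (2 * b)) ^ numMarks u * (1 - ε) ^ (unmark u).numNodes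
      ≤ lightMass c p ε (contract u).1 (treeParam c (unmark u))
        * ((contract u).2.map (tierMass (heavyMass c p ε b))).prod := by
  have hQ0 := h.heavyMass_nonneg h0 h1 b
  have hQ1 := h.heavyMass_le_one h0 h1 b
  induction u with
  | nil => simp [unmark, sourceProb, numMarks, contract, lightMass, treeParam, tierMass_nil]
  | node m l r hl hr =>
    simp only [unmark, BinaryTree.numNodes] at hu
    specialize hl (by omega)
    specialize hr (by omega)
    have hA : 0 ≤ ε / (2 * b) := by positivity
    have hω : 0 ≤ 1 - ε := by linarith
    have hnode := h.lightMass_node_ge h0 h1 (contract l).1 (contract r).1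
      (treeParam c (unmark l)) (treeParam c (unmark r))
    set i := treeParam c (unmark l)
    set j := treeParam c (unmark r)
    have hp := h.nonneg i j
    have hPr := h.sourceProb_nonneg (unmark r)
    have hSl := h.lightMass_nonneg h0 h1 (contract l).1 i
    have hSr := h.lightMass_nonneg h0 h1 (contract r).1 j
    have hTl := prod_tierMass_nonneg hQ0 (contract l).2
    have hTr := prod_tierMass_nonneg hQ0 (contract r).2
    have key : p i j * sourceProb c p (unmark l) * sourceProb c p (unmark r)
        * (ε / (2 * b)) ^ (numMarks l + numMarks r)
        * (1 - ε) ^ ((unmark l).numNodes + (unmark r).numNodes + 1)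
        ≤ lightMass c p ε (.node () (contract l).1 (contract r).1) (c i j)
          * (((contract l).2.map (tierMass (heavyMass c p ε b))).prod
            * ((contract r).2.map (tierMass (heavyMass c p ε b))).prod) := by
      calc _ = (1 - ε) * p i j * ((sourceProb c p (unmark l) * (ε / (2 * b)) ^ numMarks l
              * (1 - ε) ^ (unmark l).numNodes) * (sourceProb c p (unmark r)
              * (ε / (2 * b)) ^ numMarks r * (1 - ε) ^ (unmark r).numNodes)) := by ring
        _ ≤ (1 - ε) * p i j * ((lightMass c p ε (contract l).1 i
              * ((contract l).2.map (tierMass (heavyMass c p ε b))).prod)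
              * (lightMass c p ε (contract r).1 j
              * ((contract r).2.map (tierMass (heavyMass c p ε b))).prod)) := by
            refine mul_le_mul_of_nonneg_left ?_ (by positivity)
            exact mul_le_mul hl hr (by positivity) (by positivity)
        _ = ((1 - ε) * (p i j * lightMass c p ε (contract l).1 i
              * lightMass c p ε (contract r).1 j))
              * (((contract l).2.map (tierMass (heavyMass c p ε b))).prod
              * ((contract r).2.map (tierMass (heavyMass c p ε b))).prod) := by ring
        _ ≤ _ := mul_le_mul_of_nonneg_right hnode (by positivity)
    cases m with
    | false =>
      rw [contract_node_false]
      simpa [unmark, sourceProb, numMarks, treeParam] using key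
    | true =>
      obtain ⟨μ, hμ, hc⟩ := exists_contract_node_true l r
      rw [hc]
      -- The component above a cut ends here, so this position has the empty shape but the value of
      -- the removed subtree.
      have hnil : ε ≤ lightMass c p ε .nil (c i j) := by
        rw [lightMass]
        split
        · exact h1
        · exact le_rfl
      have hQ := h.heavyMass_ge_lightMass (b := b) (k := c i j) h0 h1
        ((h.le_add _ _).trans_lt (by
          have := h.treeParam_le (unmark l)
          have := h.treeParam_le (unmark r)
          omega)) (.node () (contract l).1 (contract r).1)
      have hS := h.lightMass_nonneg h0 h1 (.node () (contract l).1 (contract r).1) (c i j)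
      have hS0 := h.lightMass_nonneg h0 h1 .nil (c i j)
      have hl' := prod_tierMass_le_portalTree hQ0 hQ1 (contract l).2
      have hr' := prod_tierMass_le_portalTree hQ0 hQ1 (contract r).2
      have hT := mul_le_mul hl' hr' hTr (tierMass_nonneg hQ0 _)
      simp only [unmark, sourceProb, numMarks, treeParam, BinaryTree.numNodes, if_true,
        List.map_cons, List.map_nil, List.prod_cons, List.prod_nil, mul_one, tierMass_node, hμ]
      calc _ = ε / (2 * b) * (p i j * sourceProb c p (unmark l) * sourceProb c p (unmark r)
              * (ε / (2 * b)) ^ (numMarks l + numMarks r)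
              * (1 - ε) ^ ((unmark l).numNodes + (unmark r).numNodes + 1)) := by ring
        _ ≤ ε / (2 * b) * _ := mul_le_mul_of_nonneg_left key hA
        _ = ε * (1 / (2 * b) * lightMass c p ε (.node () (contract l).1 (contract r).1) (c i j)
              * (((contract l).2.map (tierMass (heavyMass c p ε b))).prod
              * ((contract r).2.map (tierMass (heavyMass c p ε b))).prod)) := by ring
        _ ≤ _ := by
            refine mul_le_mul hnil ?_ (by positivity) hS0
            exact mul_le_mul hQ hT (by positivity) (hQ0 _)

/-- The heavy nodes form a top part of the tree. If it has `H` nodes, then `H + 1` light subtrees,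
possibly empty, hang below it; each pays once to switch to the source and each heavy node pays once,
whence the exponent `2H + 1`. -/
theorem IsSource.heavy_decomposition (h : IsSource c p) (h0 : 0 ≤ ε) (h1 : ε ≤ 1) (hb : 2 ≤ b)
    (u : BinaryTree Bool) :
    sourceProb c p (unmark u) * (ε / (2 * b)) ^ numMarks u * (1 - ε) ^ (unmark u).numNodes
        * (1 / (4 * b)) ^ (2 * numHeavy b (unmark u) + 1)
      ≤ heavyMass c p ε b (contract u).1
        * ((contract u).2.map (tierMass (heavyMass c p ε b))).prod := by
  have hQ0 := h.heavyMass_nonneg h0 h1 b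
  have hQ1 := h.heavyMass_le_one h0 h1 b
  have hb' : (2 : ℝ) ≤ b := by exact_mod_cast hb
  have hD0 : (0 : ℝ) ≤ 1 / (4 * b) := by positivity
  have hD1 : 1 / (4 * (b : ℝ)) ≤ 1 / 8 := by
    apply one_div_le_one_div_of_le <;> linarith
  have hA0 : 0 ≤ ε / (2 * b) := by positivity
  have hA1 : ε / (2 * b) ≤ 1 / 4 := by
    rw [div_le_iff₀ (by positivity)]
    linarith
  have hω : 0 ≤ 1 - ε := by linarith
  have light : ∀ u : BinaryTree Bool, (unmark u).numNodes < b →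
      sourceProb c p (unmark u) * (ε / (2 * b)) ^ numMarks u * (1 - ε) ^ (unmark u).numNodes
        * (1 / (4 * b)) ^ (2 * numHeavy b (unmark u) + 1)
      ≤ heavyMass c p ε b (contract u).1
        * ((contract u).2.map (tierMass (heavyMass c p ε b))).prod := by
    intro u hu
    have hP := h.sourceProb_nonneg (unmark u)
    have h2 := h.light_decomposition h0 h1 u hu
    have h3 : (1 / (4 * (b : ℝ))) ^ (2 * numHeavy b (unmark u) + 1) ≤ 1 / (2 * b) := by
      refine (pow_le_of_le_one hD0 (by linarith) (by omega)).trans ?_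
      apply one_div_le_one_div_of_le <;> linarith
    have h4 := h.heavyMass_ge_lightMass h0 h1 ((h.treeParam_le (unmark u)).trans_lt hu)
      (contract u).1
    have hT := prod_tierMass_nonneg hQ0 (contract u).2
    have hS := h.lightMass_nonneg h0 h1 (contract u).1 (treeParam c (unmark u))
    calc _ ≤ (lightMass c p ε (contract u).1 (treeParam c (unmark u))
          * ((contract u).2.map (tierMass (heavyMass c p ε b))).prod) * (1 / (2 * b)) :=
          mul_le_mul h2 h3 (by positivity) (by positivity)
      _ = (1 / (2 * b) * lightMass c p ε (contract u).1 (treeParam c (unmark u)))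
          * ((contract u).2.map (tierMass (heavyMass c p ε b))).prod := by ring
      _ ≤ _ := mul_le_mul_of_nonneg_right h4 hT
  induction u with
  | nil => exact light _ (by simp [unmark]; omega)
  | node m l r hl hr =>
    -- For a heavy root the exponent exceeds the sum of those of the two subtrees by exactly one;
    -- this extra `1 / (4b)` pays for the weight `1/4` of generating the node.
    by_cases hu : (unmark (.node m l r)).numNodes < b
    · exact light _ hu
    have hheavy : numHeavy b (unmark (.node m l r))
        = 1 + numHeavy b (unmark l) + numHeavy b (unmark r) := by
      rw [unmark, numHeavy, if_pos]
      exact_mod_cast not_lt.1 hu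
    have hPl := h.sourceProb_nonneg (unmark l)
    have hPr := h.sourceProb_nonneg (unmark r)
    have hTl := prod_tierMass_nonneg hQ0 (contract l).2
    have hTr := prod_tierMass_nonneg hQ0 (contract r).2
    have hEl := hQ0 (contract l).1
    have hEr := hQ0 (contract r).1
    have hnode := h.heavyMass_node_ge h0 h1 b (contract l).1 (contract r).1
    set x := sourceProb c p (unmark l) * (ε / (2 * b)) ^ numMarks l * (1 - ε) ^ (unmark l).numNodes
        * (1 / (4 * b)) ^ (2 * numHeavy b (unmark l) + 1) with hx
    set y := sourceProb c p (unmark r) * (ε / (2 * b)) ^ numMarks r * (1 - ε) ^ (unmark r).numNodes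
        * (1 / (4 * b)) ^ (2 * numHeavy b (unmark r) + 1) with hy
    have hx0 : 0 ≤ x := by positivity
    have hy0 : 0 ≤ y := by positivity
    have hprod : 1 / 4 * (x * y) ≤ heavyMass c p ε b (.node () (contract l).1 (contract r).1)
        * (((contract l).2.map (tierMass (heavyMass c p ε b))).prod
          * ((contract r).2.map (tierMass (heavyMass c p ε b))).prod) := by
      calc _ ≤ 1 / 4 * ((heavyMass c p ε b (contract l).1
              * ((contract l).2.map (tierMass (heavyMass c p ε b))).prod)
            * (heavyMass c p ε b (contract r).1
              * ((contract r).2.map (tierMass (heavyMass c p ε b))).prod)) := by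
            refine mul_le_mul_of_nonneg_left ?_ (by norm_num)
            exact mul_le_mul hl hr hy0 (by positivity)
        _ = (1 / 4 * heavyMass c p ε b (contract l).1 * heavyMass c p ε b (contract r).1)
            * (((contract l).2.map (tierMass (heavyMass c p ε b))).prod
            * ((contract r).2.map (tierMass (heavyMass c p ε b))).prod) := by ring
        _ ≤ _ := mul_le_mul_of_nonneg_right hnode (by positivity)
    have hp0 := h.nonneg (treeParam c (unmark l)) (treeParam c (unmark r))
    have hp1 := h.le_one (treeParam c (unmark l)) (treeParam c (unmark r))
    have hpω : p (treeParam c (unmark l)) (treeParam c (unmark r)) * (1 - ε) ≤ 1 :=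
      mul_le_one₀ hp1 hω (by linarith)
    have hpω0 := mul_nonneg hp0 hω
    cases m with
    | false =>
      rw [contract_node_false, hheavy]
      simp only [unmark, sourceProb, numMarks, BinaryTree.numNodes, List.map_append,
        List.prod_append, Bool.false_eq_true, if_false]
      refine le_trans ?_ hprod
      calc _ = (p (treeParam c (unmark l)) (treeParam c (unmark r)) * (1 - ε))
            * ((1 / (4 * b)) * (x * y)) := by rw [hx, hy]; ring
        _ ≤ 1 * ((1 / (4 * b)) * (x * y)) := mul_le_mul_of_nonneg_right hpω (by positivity)
        _ ≤ _ := by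
          rw [one_mul]
          exact mul_le_mul_of_nonneg_right (by linarith) (by positivity)
    | true =>
      obtain ⟨μ, hμ, hc⟩ := exists_contract_node_true l r
      rw [hc, hheavy]
      have hl' := prod_tierMass_le_portalTree hQ0 hQ1 (contract l).2
      have hr' := prod_tierMass_le_portalTree hQ0 hQ1 (contract r).2
      have hT := mul_le_mul hl' hr' hTr (tierMass_nonneg hQ0 _)
      have hnil := h.heavyMass_nil_ge h0 h1 b
      simp only [unmark, sourceProb, numMarks, BinaryTree.numNodes, if_true,
        List.map_cons, List.map_nil, List.prod_cons, List.prod_nil, mul_one, tierMass_node, hμ]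
      -- Here the factor `ε / (2b) ≤ 1/4` of the mark only has to pay for the null pointer that the
      -- cut leaves in the upper component.
      calc _ = (p (treeParam c (unmark l)) (treeParam c (unmark r)) * (1 - ε))
            * ((ε / (2 * b)) * ((1 / (4 * b)) * (x * y))) := by rw [hx, hy]; ring
        _ ≤ 1 * (1 / 4 * ((1 / 4) * (x * y))) := by
          refine mul_le_mul hpω (mul_le_mul hA1 ?_ (by positivity) (by norm_num))
            (by positivity) zero_le_one
          exact mul_le_mul_of_nonneg_right (by linarith) (by positivity)
        _ ≤ _ := by
          rw [one_mul]
          refine mul_le_mul hnil (hprod.trans ?_) (by positivity) (hQ0 _)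
          exact mul_le_mul_of_nonneg_left hT (hQ0 _)

end Source

/-! ### The Farzan–Munro decomposition -/

theorem unmark_declarePermanent (u : BinaryTree Bool) :
    unmark (declarePermanent u) = unmark u := by
  cases u <;> rfl

theorem unmark_farzanMunro (B : ℕ) (t : BinaryTree Unit) : unmark (farzanMunro B t) = t := by
  induction t with
  | nil => rfl
  | node a l r hl hr =>
    rw [farzanMunro]
    split <;> simp [unmark, unmark_declarePermanent, hl, hr]

theorem numMarks_declarePermanent_le (u : BinaryTree Bool) :
    numMarks (declarePermanent u) ≤ numMarks u + 1 := by
  cases u with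
  | nil => simp [declarePermanent, numMarks]
  | node m l r => cases m <;> (simp [declarePermanent, numMarks]; try omega)

theorem activeSize_declarePermanent (u : BinaryTree Bool) :
    activeSize (declarePermanent u) = 0 := by
  cases u <;> rfl

theorem activeSize_farzanMunro_lt {B : ℕ} (hB : 1 ≤ B) (t : BinaryTree Unit) :
    activeSize (farzanMunro B t) < B := by
  cases t with
  | nil => exact hB
  | node a l r =>
    rw [farzanMunro]
    split
    · exact hB
    · by_cases h : B ≤ activeSize (farzanMunro B l) + activeSize (farzanMunro B r) + 1
      · rw [decide_eq_true h]
        exact hB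
      · rw [decide_eq_false h]
        exact not_le.1 h

/-- A tree with fewer than `B` nodes has no marks, and otherwise the number of marks is at most
`4 / B` times the number of nodes. -/
theorem farzanMunro_marks {B : ℕ} (hB : 1 ≤ B) (t : BinaryTree Unit) :
    (t.numNodes < B → numMarks (farzanMunro B t) = 0 ∧
      activeSize (farzanMunro B t) = t.numNodes) ∧
    (B ≤ t.numNodes → B * numMarks (farzanMunro B t) + activeSize (farzanMunro B t) + 3 * B
      ≤ 4 * t.numNodes) := by
  induction t with
  | nil =>
    refine ⟨fun _ => ⟨rfl, rfl⟩, fun h => ?_⟩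
    simp at h
    omega
  | node a l r hl hr =>
    simp only [BinaryTree.numNodes]
    rw [farzanMunro]
    split
    · rename_i h
      refine ⟨fun h' => by omega, fun _ => ?_⟩
      have h1 := hl.2 h.1
      have h2 := hr.2 h.2
      have h3 := Nat.mul_le_mul_left B (numMarks_declarePermanent_le (farzanMunro B l))
      have h4 := Nat.mul_le_mul_left B (numMarks_declarePermanent_le (farzanMunro B r))
      simp only [numMarks, activeSize, if_true, Nat.mul_add, Nat.mul_one] at h3 h4 ⊢
      -- Up to three new marks arise here, at the node and at its children. They are paid by the
      -- term `3 * B`, which both heavy children supply and only one copy of which must be kept.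
      omega
    · rename_i h
      by_cases ha : B ≤ activeSize (farzanMunro B l) + activeSize (farzanMunro B r) + 1
      -- The new mark is paid by the active nodes, at least `B` in number, that cease to be active.
      · simp only [ha, decide_true, numMarks, activeSize, if_true, Nat.mul_add, Nat.mul_one]
        by_cases h1 : B ≤ l.numNodes
        · have h2 := hl.2 h1
          have h3 := hr.1 (by omega)
          rw [h3.1]
          refine ⟨fun h' => by omega, fun _ => by omega⟩
        · have h2 := hl.1 (by omega)
          rw [h2.1]
          by_cases h3 : B ≤ r.numNodes
          · have h4 := hr.2 h3
            refine ⟨fun h' => by omega, fun _ => by omega⟩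
          · have h4 := hr.1 (by omega)
            rw [h4.1]
            refine ⟨fun h' => by omega, fun _ => by omega⟩
      · simp only [ha, decide_false, numMarks, activeSize, Bool.false_eq_true, if_false, Nat.mul_add,
          Nat.zero_add]
        by_cases h1 : B ≤ l.numNodes
        · have h2 := hl.2 h1
          have h3 := hr.1 (by omega)
          rw [h3.1]
          refine ⟨fun h' => by omega, fun _ => by omega⟩
        · have h2 := hl.1 (by omega)
          rw [h2.1]
          by_cases h3 : B ≤ r.numNodes
          · have h4 := hr.2 h3
            refine ⟨fun h' => by omega, fun _ => by omega⟩
          · have h4 := hr.1 (by omega)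
            rw [h4.1]
            refine ⟨fun h' => by omega, fun _ => by omega⟩

theorem numMarks_le {B : ℕ} (hB : 1 ≤ B) (t : BinaryTree Unit) :
    B * numMarks (declarePermanent (farzanMunro B t)) ≤ 4 * t.numNodes + B := by
  have h1 := Nat.mul_le_mul_left B (numMarks_declarePermanent_le (farzanMunro B t))
  rw [Nat.mul_add, Nat.mul_one] at h1
  have h2 := farzanMunro_marks hB t
  rcases lt_or_ge t.numNodes B with h | h
  · rw [(h2.1 h).1] at h1
    omega
  · have := h2.2 h
    omega

/-- All components have at most `k` nodes. -/
def ComponentsLE (k : ℕ) : BinaryTree Bool → Prop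
  | .nil => True
  | .node _ l r => activeSize l + activeSize r + 1 ≤ k ∧ ComponentsLE k l ∧ ComponentsLE k r

theorem ComponentsLE.declarePermanent {k : ℕ} {u : BinaryTree Bool} (h : ComponentsLE k u) :
    ComponentsLE k (declarePermanent u) := by
  cases u with
  | nil => trivial
  | node m l r => exact h

theorem componentsLE_farzanMunro {B : ℕ} (hB : 1 ≤ B) (t : BinaryTree Unit) :
    ComponentsLE (2 * B) (farzanMunro B t) := by
  induction t with
  | nil => trivial
  | node a l r hl hr =>
    rw [farzanMunro]
    split
    · refine ⟨?_, hl.declarePermanent, hr.declarePermanent⟩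
      simp only [activeSize_declarePermanent]
      omega
    · refine ⟨?_, hl, hr⟩
      have := activeSize_farzanMunro_lt hB l
      have := activeSize_farzanMunro_lt hB r
      omega

theorem numNodes_contract_fst (u : BinaryTree Bool) :
    (contract u).1.numNodes = activeSize u := by
  induction u with
  | nil => rfl
  | node m l r hl hr =>
    cases m
    · rw [contract_node_false]
      simp [activeSize, hl, hr]
    · rfl

theorem mem_of_mem_preorder_portalTree {L : List (BinaryTree MicroTree)} {μ : MicroTree}
    (h : μ ∈ preorder (portalTree L)) : ∃ T ∈ L, μ ∈ preorder T := by
  unfold portalTree at h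
  cases hf : L.find? isNonempty with
  | none => simp [hf, preorder] at h
  | some T => exact ⟨T, List.mem_of_find?_eq_some hf, by simpa [hf] using h⟩

theorem ComponentsLE.numNodes_shape_le {k : ℕ} {u : BinaryTree Bool} (h : ComponentsLE k u) :
    ∀ T ∈ (contract u).2, ∀ μ ∈ preorder T, μ.shape.numNodes ≤ k := by
  induction u with
  | nil =>
    intro T hT μ hμ
    simp only [contract, List.mem_singleton] at hT
    subst hT
    simp [preorder] at hμ
  | node m l r hl hr =>
    specialize hl h.2.1
    specialize hr h.2.2
    cases m with
    | false =>
      rw [contract_node_false]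
      intro T hT
      rcases List.mem_append.1 hT with hT | hT
      · exact hl T hT
      · exact hr T hT
    | true =>
      obtain ⟨ν, hν, hc⟩ := exists_contract_node_true l r
      rw [hc]
      intro T hT μ hμ
      rw [List.mem_singleton] at hT
      subst hT
      simp only [preorder, List.mem_cons, List.mem_append] at hμ
      rcases hμ with rfl | hμ | hμ
      · rw [hν]
        simpa [numNodes_contract_fst] using h.1
      · obtain ⟨T, hT, hμT⟩ := mem_of_mem_preorder_portalTree hμ
        exact hl T hT μ hμT
      · obtain ⟨T, hT, hμT⟩ := mem_of_mem_preorder_portalTree hμ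
        exact hr T hT μ hμT

theorem numNodes_shape_le {B : ℕ} (hB : 1 ≤ B) (t s : BinaryTree Unit) (hs : s ∈ microShapes B t) :
    s.numNodes ≤ 2 * B := by
  obtain ⟨μ, hμ, rfl⟩ := List.mem_map.1 hs
  obtain ⟨T, hT, hμT⟩ := mem_of_mem_preorder_portalTree hμ
  exact (componentsLE_farzanMunro hB t).declarePermanent.numNodes_shape_le T hT μ hμT

theorem numNodes_portalTree_le (L : List (BinaryTree MicroTree)) :
    (portalTree L).numNodes ≤ (L.map BinaryTree.numNodes).sum := by
  unfold portalTree
  cases hf : L.find? isNonempty with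
  | none => simp
  | some T =>
    exact List.single_le_sum (by simp) _ (List.mem_map_of_mem (List.mem_of_find?_eq_some hf))

theorem sum_numNodes_contract_le (u : BinaryTree Bool) :
    ((contract u).2.map BinaryTree.numNodes).sum ≤ numMarks u := by
  induction u with
  | nil => simp [contract]
  | node m l r hl hr =>
    cases m with
    | false =>
      rw [contract_node_false]
      simp [numMarks]
      omega
    | true =>
      obtain ⟨ν, hν, hc⟩ := exists_contract_node_true l r
      have := numNodes_portalTree_le (contract l).2
      have := numNodes_portalTree_le (contract r).2
      rw [hc]
      simp [numMarks]
      omega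

theorem length_preorder {α : Type*} (t : BinaryTree α) : (preorder t).length = t.numNodes := by
  induction t with
  | nil => rfl
  | node a l r hl hr => simp [preorder, hl, hr]

theorem length_microShapes_le (B : ℕ) (t : BinaryTree Unit) :
    (microShapes B t).length ≤ numMarks (declarePermanent (farzanMunro B t)) := by
  rw [microShapes, List.length_map, length_preorder]
  exact (numNodes_portalTree_le _).trans (sum_numNodes_contract_le _)

/-- `n + 1` is the number of null pointers, which is additive over the two subtrees of a node; a
light subtree has at most `B` of them. It turns `n / β` into a multiple of the number of heavy
nodes. -/
theorem numNodes_le_numHeavy {B : ℕ} (hB : 1 ≤ B) (t : BinaryTree Unit) :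
    t.numNodes + 1 ≤ 2 * B * numHeavy B t + B := by
  induction t with
  | nil => simpa [numHeavy] using hB
  | node a l r hl hr =>
    by_cases h : B ≤ (BinaryTree.node a l r).numNodes
    · rw [numHeavy, if_pos (by exact_mod_cast h), BinaryTree.numNodes, Nat.mul_add, Nat.mul_add]
      omega
    · have : 0 ≤ 2 * B * numHeavy B (.node a l r) := Nat.zero_le _
      omega

/-! ### From masses to code lengths -/

/-! ### The code length of the micro trees -/

/-- Cross entropy with `heavyMass` at `ε = 1 / b`, which balances the cost `lg (2b²)` of a cut
against the total loss `O(n / b)` over the nodes. -/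
theorem IsSource.sum_huffmanCode_le {c : ℕ → ℕ → ℕ} {p : ℕ → ℕ → ℝ} (h : IsSource c p) {b : ℕ}
    (hb : 2 ≤ b) (B : ℕ) (t : BinaryTree Unit) (ht : 0 < sourceProb c p t) :
    (((microShapes B t).map (fun s => (huffmanCode (microShapes B t) s).length)).sum : ℝ)
      ≤ Real.logb 2 (1 / sourceProb c p t)
        + (4 * numMarks (declarePermanent (farzanMunro B t)) + 6 * numHeavy b t + 3)
          * Real.logb 2 b + 4 * t.numNodes / b := by
  have hb' : (2 : ℝ) ≤ b := by exact_mod_cast hb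
  have h0 : (0 : ℝ) ≤ 1 / b := by positivity
  have h1 : 1 / (b : ℝ) ≤ 1 / 2 := one_div_le_one_div_of_le (by norm_num) hb'
  have h1' : 1 / (b : ℝ) ≤ 1 := h1.trans (by norm_num)
  have hQ0 := h.heavyMass_nonneg h0 h1' b
  have hQ1 := h.heavyMass_le_one h0 h1' b
  set u := declarePermanent (farzanMunro B t) with hu
  have hut : unmark u = t := by rw [hu, unmark_declarePermanent, unmark_farzanMunro]
  have hdec := h.heavy_decomposition h0 h1' hb u
  rw [hut] at hdec
  have hω : 0 < 1 - 1 / (b : ℝ) := by linarith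
  set M := numMarks u
  set x := sourceProb c p t * (1 / (b : ℝ) / (2 * b)) ^ M * (1 - 1 / (b : ℝ)) ^ t.numNodes
        * (1 / (4 * (b : ℝ))) ^ (2 * numHeavy b t + 1) with hx
  have hx0 : 0 < x := by positivity
  have hxT : x ≤ ((microShapes B t).map (heavyMass c p (1 / b) b)).prod := by
    have h2 : x ≤ tierMass (heavyMass c p (1 / b) b) (topTier B t) :=
      hdec.trans ((mul_le_of_le_one_left (prod_tierMass_nonneg hQ0 _) (hQ1 _)).trans
        (prod_tierMass_le_portalTree hQ0 hQ1 _))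
    rwa [tierMass, show (fun μ : MicroTree => heavyMass c p (1 / b) b μ.shape)
      = heavyMass c p (1 / b) b ∘ MicroTree.shape from rfl, ← List.map_map] at h2
  -- Each shape that occurs has positive mass because the whole product is at least `x > 0`.
  have hpos : ∀ s ∈ microShapes B t, 0 < heavyMass c p (1 / b) b s := by
    intro s hs
    refine (hQ0 s).lt_of_ne fun h0 => ?_
    have : ((microShapes B t).map (heavyMass c p (1 / b) b)).prod = 0 :=
      List.prod_eq_zero (List.mem_map.2 ⟨s, hs, h0.symm⟩)
    linarith
  have hcross := sum_huffmanCode_le_crossEntropy (microShapes B t) (heavyMass c p (1 / b) b) hpos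
    (h.sum_heavyMass_le_one h0 h1' b _)
  have hlogprod : ∀ L : List (BinaryTree Unit), (∀ s ∈ L, 0 < heavyMass c p (1 / b) b s) →
      Real.logb 2 (L.map (heavyMass c p (1 / b) b)).prod
        = (L.map (fun s => Real.logb 2 (heavyMass c p (1 / b) b s))).sum := by
    intro L hL
    induction L with
    | nil => simp
    | cons s L ih =>
      have hL' : ∀ s ∈ L, 0 < heavyMass c p (1 / b) b s := fun s hs => hL s (by simp [hs])
      have hp : 0 < (L.map (heavyMass c p (1 / b) b)).prod := List.prod_pos (by simpa using hL')
      rw [List.map_cons, List.prod_cons, Real.logb_mul (hL s (by simp)).ne' hp.ne', ih hL']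
      simp
  rw [← hlogprod _ hpos] at hcross
  have hlog := Real.logb_le_logb_of_le one_lt_two hx0 hxT
  have hm : ((microShapes B t).length : ℝ) ≤ M := by exact_mod_cast length_microShapes_le B t
  have hlgb : 1 ≤ Real.logb 2 b := by
    rw [Real.le_logb_iff_rpow_le one_lt_two (by positivity)]
    simpa using hb'
  have hb0 : (b : ℝ) ≠ 0 := by positivity
  have hlogx : Real.logb 2 x = Real.logb 2 (sourceProb c p t)
      - M * (1 + 2 * Real.logb 2 b) + t.numNodes * Real.logb 2 (1 - 1 / (b : ℝ))
      - (2 * numHeavy b t + 1) * (2 + Real.logb 2 b) := by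
    rw [hx, Real.logb_mul (by positivity) (by positivity),
      Real.logb_mul (by positivity) (by positivity), Real.logb_mul (by positivity) (by positivity),
      Real.logb_pow, Real.logb_pow, Real.logb_pow, div_div, one_div (b * (2 * b) : ℝ),
      one_div (4 * b : ℝ), Real.logb_inv, Real.logb_inv, Real.logb_mul hb0 (by positivity), Real.logb_mul two_ne_zero hb0,
      Real.logb_mul four_ne_zero hb0, Real.logb_self_eq_one one_lt_two,
      show Real.logb 2 4 = 2 by
        rw [Real.logb_eq_iff_rpow_eq (by norm_num) (by norm_num) (by norm_num)]; norm_num]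
    push_cast
    ring
  have hωlog : -(4 / (b : ℝ)) ≤ Real.logb 2 (1 - 1 / (b : ℝ)) := by
    have h2 := Real.one_sub_inv_le_log_of_pos hω
    have h3 : -(2 / (b : ℝ)) ≤ 1 - (1 - 1 / (b : ℝ))⁻¹ := by
      have : (1 - 1 / (b : ℝ))⁻¹ = 1 + 1 / (b - 1) := by
        have : (b : ℝ) - 1 ≠ 0 := by linarith
        field_simp
        ring
      rw [this]
      have : 1 / ((b : ℝ) - 1) ≤ 2 / b := by
        rw [div_le_div_iff₀ (by linarith) (by linarith)]
        linarith
      linarith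
    have h4 := Real.log_two_gt_d9
    rw [Real.logb, le_div_iff₀ (by linarith)]
    have h5 : 0 ≤ 2 / (b : ℝ) := by positivity
    have h6 : 4 / (b : ℝ) = 2 * (2 / b) := by ring
    rw [h6]
    nlinarith
  have hn : (0 : ℝ) ≤ t.numNodes := Nat.cast_nonneg _
  have hM : (0 : ℝ) ≤ M := Nat.cast_nonneg _
  have hN : (0 : ℝ) ≤ numHeavy b t := Nat.cast_nonneg _
  have e1 := mul_le_mul_of_nonneg_left hωlog hn
  have e2 : (t.numNodes : ℝ) * -(4 / b) = - (4 * t.numNodes / b) := by ring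
  rw [one_div, Real.logb_inv]
  nlinarith

/-! ### The length of the hypersuccinct code -/

theorem length_fixedWidth (w k : ℕ) : (fixedWidth w k).length = w := by
  simp [fixedWidth]

theorem length_eliasGamma (k : ℕ) : (eliasGamma k).length = 2 * Nat.log 2 k + 1 := by
  rw [eliasGamma, List.length_append, List.length_replicate, length_fixedWidth]
  ring

theorem length_eliasGamma_le (k : ℕ) : (eliasGamma k).length ≤ 2 * k + 1 := by
  rw [length_eliasGamma]
  have := Nat.log_le_self 2 k
  omega

theorem length_balancedParens {α : Type*} (t : BinaryTree α) :
    (balancedParens t).length = 2 * t.numNodes := by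
  induction t with
  | nil => rfl
  | node a l r hl hr =>
    simp [balancedParens, hl, hr]
    ring

/-- The escape encoding is used only when it costs at most one bit more than the codeword. -/
theorem length_lengthRestricted_le (C : BinaryTree Unit → List Bool) (t : BinaryTree Unit) :
    (lengthRestricted C t).length ≤ (C t).length + 1 := by
  unfold lengthRestricted
  split
  · rw [List.length_cons, List.length_append, length_eliasGamma, length_balancedParens]
    omega
  · simp

theorem length_lengthRestricted_le_size (C : BinaryTree Unit → List Bool) (t : BinaryTree Unit) :
    (lengthRestricted C t).length ≤ 4 * t.numNodes + 2 := by
  have : Nat.log 2 (t.numNodes + 1) ≤ t.numNodes :=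
    Nat.lt_succ_iff.1 (Nat.log_lt_self 2 (by omega))
  unfold lengthRestricted
  split
  · rw [List.length_cons, List.length_append, length_eliasGamma, length_balancedParens]
    omega
  · rw [List.length_cons]
    omega

theorem card_le_of_numNodes_le (F : Finset (BinaryTree Unit)) (k : ℕ)
    (h : ∀ t ∈ F, t.numNodes ≤ k) : F.card ≤ 4 ^ (k + 1) := by
  have hsub : F ⊆ (Finset.range (k + 1)).biUnion BinaryTree.treesOfNumNodesEq := by
    intro t ht
    rw [Finset.mem_biUnion]
    exact ⟨t.numNodes, Finset.mem_range.2 (Nat.lt_succ_iff.2 (h t ht)),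
      BinaryTree.mem_treesOfNumNodesEq_numNodes t⟩
  refine (Finset.card_le_card hsub).trans (Finset.card_biUnion_le.trans ?_)
  refine le_trans (Finset.sum_le_sum fun i _ => ?_) (Nat.geomSum_lt (m := 4) (n := k + 1)
    (s := Finset.range (k + 1)) (by norm_num) (fun i hi => Finset.mem_range.1 hi)).le
  rw [BinaryTree.treesOfNumNodesEq_card_eq_catalan, catalan_eq_centralBinom_div]
  refine (Nat.div_le_self _ _).trans ?_
  rw [Nat.centralBinom_eq_two_mul_choose, show 4 = 2 ^ 2 by norm_num, ← pow_mul]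
  exact Nat.choose_le_two_pow _ _

theorem length_flatMap_le {α β : Type*} (L : List α) (f : α → List β) (k : ℕ)
    (h : ∀ a ∈ L, (f a).length ≤ k) : (L.flatMap f).length ≤ L.length * k := by
  rw [List.length_flatMap]
  simpa using List.sum_le_card_nsmul (L.map fun a => (f a).length) k (by simpa using h)

/-- Per micro tree: `2` bits for `γ(m)`, `2` for the top tier, `1` for the flag, and the portals.
Shapes have at most `2B` nodes, so a table entry has at most `32 * B + 8` bits; the remaining `2`
per entry come from `γ` of their number. -/
theorem length_encode_le {B : ℕ} (hB : 1 ≤ B) (M : ℕ) (t : BinaryTree Unit) :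
    (encode B M t).length ≤ 2 * Nat.log 2 t.numNodes + 3 + 4 ^ (2 * B + 1) * (32 * B + 10)
      + numMarks (declarePermanent (farzanMunro B t)) * (5 + 2 * Nat.clog 2 (M + 1))
      + ((microShapes B t).map (fun s => (huffmanCode (microShapes B t) s).length)).sum := by
  set S := microShapes B t with hS
  have hm : S.length ≤ numMarks (declarePermanent (farzanMunro B t)) := length_microShapes_le B t
  have hmlen : S.length = (preorder (topTier B t)).length := by rw [hS, microShapes, List.length_map]
  have hd : S.dedup.length ≤ 4 ^ (2 * B + 1) := by
    rw [← List.card_toFinset]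
    exact card_le_of_numNodes_le _ _ fun s hs =>
      numNodes_shape_le hB t s (List.mem_toFinset.1 hs)
  have h1 := length_eliasGamma_le S.length
  have h2 := length_eliasGamma_le S.dedup.length
  have h3 : (S.dedup.flatMap (fun s => eliasGamma (lengthRestricted (huffmanCode S) s).length
      ++ lengthRestricted (huffmanCode S) s ++ eliasGamma s.numNodes
      ++ balancedParens s)).length ≤ S.dedup.length * (32 * B + 8) := by
    refine length_flatMap_le _ _ _ fun s hs => ?_
    have hk := numNodes_shape_le hB t s (List.mem_dedup.1 hs)
    have e1 := length_lengthRestricted_le_size (huffmanCode S) s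
    have e2 := length_eliasGamma_le (lengthRestricted (huffmanCode S) s).length
    have e3 := length_eliasGamma_le s.numNodes
    simp only [List.length_append, length_balancedParens]
    omega
  have h4 : (S.flatMap (lengthRestricted (huffmanCode S))).length
      ≤ S.length + (S.map (fun s => (huffmanCode S s).length)).sum := by
    rw [List.length_flatMap]
    refine (List.sum_le_sum fun s _ => length_lengthRestricted_le (huffmanCode S) s).trans ?_
    rw [List.sum_map_add]
    simp [Nat.add_comm]
  have h5 := length_flatMap_le (preorder (topTier B t)) (fun μ =>
      fixedWidth (Nat.clog 2 (M + 1)) μ.leftPortal ++ fixedWidth (Nat.clog 2 (M + 1)) μ.rightPortal)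
      (2 * Nat.clog 2 (M + 1)) (fun μ _ => by
        rw [List.length_append, length_fixedWidth, length_fixedWidth]; omega)
  have h6 := Nat.mul_le_mul_right (32 * B + 10) hd
  have h7 := Nat.mul_le_mul_right (5 + 2 * Nat.clog 2 (M + 1)) hm
  have h8 : (topTier B t).numNodes = S.length := by rw [hmlen, length_preorder]
  have e1 : S.dedup.length * (32 * B + 10) = S.dedup.length * (32 * B + 8)
    + 2 * S.dedup.length := by ring
  have e2 : S.length * (5 + 2 * Nat.clog 2 (M + 1)) = 5 * S.length
    + S.length * (2 * Nat.clog 2 (M + 1)) := by ring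
  rw [← hmlen] at h5
  unfold encode
  simp only [← hS, ← hmlen, h8, List.length_append, length_balancedParens,
    length_eliasGamma t.numNodes] at h1 h2 h3 h4 h5 ⊢
  linarith

/-! ### Explicit bounds for a single tree -/

theorem numHeavy_anti {b b' : ℝ} (h : b ≤ b') (t : BinaryTree Unit) :
    numHeavy b' t ≤ numHeavy b t := by
  induction t with
  | nil => exact le_rfl
  | node a l r hl hr =>
    rw [numHeavy, numHeavy]
    by_cases hb : b' ≤ ((BinaryTree.node a l r).numNodes : ℝ)
    · rw [if_pos hb, if_pos (h.trans hb)]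
      omega
    · rw [if_neg hb]
      omega

theorem one_le_coverParam (n : ℕ) : 1 ≤ coverParam n := le_max_left _ _

theorem logb_two_natCast_nonneg (n : ℕ) : 0 ≤ Real.logb 2 (n : ℝ) := by
  rcases Nat.eq_zero_or_pos n with rfl | hn
  · simp
  · exact Real.logb_nonneg one_lt_two (by exact_mod_cast hn)

theorem le_coverParam (n : ℕ) : Real.logb 2 n / 8 ≤ coverParam n :=
  (Nat.le_ceil _).trans (by exact_mod_cast le_max_right _ _)

theorem coverParam_le (n : ℕ) : (coverParam n : ℝ) ≤ Real.logb 2 n / 8 + 1 := by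
  have h := logb_two_natCast_nonneg n
  rw [coverParam, Nat.cast_max, Nat.cast_one]
  exact max_le (by linarith) (Nat.ceil_lt_add_one (by positivity)).le

theorem microBound_le (n : ℕ) : microBound n ≤ 2 * coverParam n := by
  refine Nat.ceil_le.2 ?_
  have := le_coverParam n
  push_cast
  linarith

theorem one_le_logb_two {b : ℕ} (hb : 2 ≤ b) : 1 ≤ Real.logb 2 (b : ℝ) := by
  rw [Real.le_logb_iff_rpow_le one_lt_two (by positivity)]
  simpa using (by exact_mod_cast hb : (2 : ℝ) ≤ b)

theorem clog_microBound_le {n b : ℕ} (hb : 2 ≤ b) (hβ : coverParam n ≤ b) :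
    (Nat.clog 2 (microBound n + 1) : ℝ) ≤ 4 * Real.logb 2 b := by
  have h1 : microBound n + 1 ≤ 4 * b := by
    have := microBound_le n
    omega
  have h2 := one_le_logb_two hb
  have hb0 : (b : ℝ) ≠ 0 := by positivity
  have h3 := Nat.clog_mono_right 2 h1
  have h4 : (Nat.clog 2 (4 * b) : ℝ) ≤ Real.logb 2 (4 * b : ℕ) + 1 := by
    rw [← Real.natCeil_logb_natCast]
    exact (Nat.ceil_lt_add_one (logb_two_natCast_nonneg _)).le
  have h5 : Real.logb 2 (4 * b : ℕ) = 2 + Real.logb 2 b := by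
    push_cast
    rw [Real.logb_mul four_ne_zero hb0, show Real.logb 2 4 = 2 by
      rw [Real.logb_eq_iff_rpow_eq (by norm_num) (by norm_num) (by norm_num)]; norm_num]
  have h6 : (Nat.clog 2 (microBound n + 1) : ℝ) ≤ Nat.clog 2 (4 * b) := by exact_mod_cast h3
  linarith

theorem numMarks_le_div {B : ℕ} (hB : 1 ≤ B) (t : BinaryTree Unit) :
    (numMarks (declarePermanent (farzanMunro B t)) : ℝ) ≤ 4 * (t.numNodes / B) + 1 := by
  have hB0 : (0 : ℝ) < B := by exact_mod_cast hB
  have h : (B : ℝ) * numMarks (declarePermanent (farzanMunro B t)) ≤ 4 * t.numNodes + B := by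
    exact_mod_cast numMarks_le hB t
  rw [← mul_le_mul_iff_right₀ hB0]
  refine h.trans (le_of_eq ?_)
  field_simp

/-- The part of the bound for the length of the hypersuccinct code that depends on the number of
nodes only. -/
noncomputable def codeRemainder (n b : ℕ) : ℝ :=
  2 * Real.logb 2 n + 3 + 4 ^ (2 * coverParam n + 1) * (32 * coverParam n + 10)
    + (68 * (n / coverParam n) + 20) * Real.logb 2 b + 4 * (n / b)

theorem codeRemainder_nonneg (n : ℕ) {b : ℕ} (hb : 2 ≤ b) : 0 ≤ codeRemainder n b := by
  have h1 := logb_two_natCast_nonneg n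
  have h2 := one_le_logb_two hb
  unfold codeRemainder
  positivity

theorem IsSource.length_hypersuccinct_le {c : ℕ → ℕ → ℕ} {p : ℕ → ℕ → ℝ} (h : IsSource c p)
    {b : ℕ} (hb : 2 ≤ b) (t : BinaryTree Unit) (hβ : coverParam t.numNodes ≤ b)
    (ht : 0 < sourceProb c p t) :
    ((hypersuccinct t).length : ℝ) ≤ Real.logb 2 (1 / sourceProb c p t)
      + (6 * (numHeavy b t * Real.logb 2 b) + codeRemainder t.numNodes b) := by
  have hB := one_le_coverParam t.numNodes
  have h1 : ((hypersuccinct t).length : ℝ) ≤ _ :=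
    Nat.cast_le.2 (length_encode_le hB (microBound t.numNodes) t)
  have h2 := h.sum_huffmanCode_le hb (coverParam t.numNodes) t ht
  have h3 := numMarks_le_div hB t
  have h4 := clog_microBound_le hb hβ
  have h5 := one_le_logb_two hb
  have h6 : (Nat.log 2 t.numNodes : ℝ) ≤ Real.logb 2 t.numNodes := Real.natLog_le_logb _ _
  push_cast at h1 h2
  set M : ℝ := (numMarks (declarePermanent (farzanMunro (coverParam t.numNodes) t)) : ℝ)
  have hM : 0 ≤ M := Nat.cast_nonneg _
  have e1 : M * (5 + 2 * (Nat.clog 2 (microBound t.numNodes + 1) : ℝ))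
      ≤ 13 * (M * Real.logb 2 b) := by
    have := mul_le_mul_of_nonneg_left
      (show 5 + 2 * (Nat.clog 2 (microBound t.numNodes + 1) : ℝ) ≤ 13 * Real.logb 2 b by linarith) hM
    linarith
  have e2 := mul_le_mul_of_nonneg_right h3 (show 0 ≤ Real.logb 2 (b : ℝ) by linarith)
  -- The marks contribute `(13 + 4) M lg b` with `M ≤ 4 n / β + 1`, which gives `68` and, with the
  -- additional `3 lg b`, the constant `20`.
  unfold codeRemainder
  rw [mul_div_assoc] at h2
  linarith

/-- Here `b = β`. For `n ≥ 2 ^ 9` one has `2 ≤ β ≤ n`, so the root is heavy and additive constants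
are absorbed by `H ≥ 1`. -/
theorem IsSource.microTreeCodeLength_le {c : ℕ → ℕ → ℕ} {p : ℕ → ℕ → ℝ} (h : IsSource c p)
    (t : BinaryTree Unit) (hn : 2 ^ 9 ≤ t.numNodes) (ht : 0 < sourceProb c p t) :
    (microTreeCodeLength t : ℝ) ≤ Real.logb 2 (1 / sourceProb c p t)
      + 73 * ((numHeavy (coverParam t.numNodes) t : ℝ) * Real.logb 2 (coverParam t.numNodes)) := by
  have hn' : (2 : ℝ) ^ 9 ≤ t.numNodes := by exact_mod_cast hn
  have hlg : 9 ≤ Real.logb 2 t.numNodes := by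
    rw [Real.le_logb_iff_rpow_le one_lt_two (by positivity)]
    exact_mod_cast hn
  have hβ2 : 2 ≤ coverParam t.numNodes := by
    have := le_coverParam t.numNodes
    have : (1 : ℝ) < coverParam t.numNodes := by linarith
    exact_mod_cast this
  have hlgle : Real.logb 2 t.numNodes ≤ t.numNodes := by
    rw [Real.logb_le_iff_le_rpow one_lt_two (by positivity), Real.rpow_natCast]
    exact_mod_cast Nat.lt_two_pow_self.le
  have hβn : (coverParam t.numNodes : ℝ) ≤ t.numNodes := by
    have := coverParam_le t.numNodes
    linarith
  have h1 := h.sum_huffmanCode_le hβ2 (coverParam t.numNodes) t ht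
  have h2 := numMarks_le_div (one_le_coverParam t.numNodes) t
  have h3 := numNodes_le_numHeavy (one_le_coverParam t.numNodes) t
  have h4 : 1 ≤ numHeavy (coverParam t.numNodes) t := by
    cases t with
    | nil => simp at hn
    | node a l r =>
      rw [numHeavy, if_pos hβn]
      omega
  have h5 := one_le_logb_two hβ2
  have hβ0 : (0 : ℝ) < coverParam t.numNodes := by positivity
  have h6 : (t.numNodes : ℝ) / coverParam t.numNodes
      ≤ 2 * numHeavy (coverParam t.numNodes) t + 1 := by
    rw [div_le_iff₀ hβ0]
    have : (t.numNodes : ℝ) + 1 ≤ 2 * coverParam t.numNodes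
        * numHeavy (coverParam t.numNodes) t + coverParam t.numNodes := by exact_mod_cast h3
    linarith
  have h7 : (1 : ℝ) ≤ numHeavy (coverParam t.numNodes) t := by exact_mod_cast h4
  refine h1.trans ?_
  rw [mul_div_assoc, add_assoc]
  gcongr
  set H : ℝ := (numHeavy (coverParam t.numNodes) t : ℝ)
  set lg := Real.logb 2 (coverParam t.numNodes)
  set M : ℝ := (numMarks (declarePermanent (farzanMunro (coverParam t.numNodes) t)) : ℝ)
  -- `M ≤ 4 (2H + 1) + 1 ≤ 13 H`, so the left factor is at most `52 H + 6 H + 3 H`. The term `4 n /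
  -- β ≤ 12 H` then completes `73`.
  have h8 : (4 * M + 6 * H + 3) * lg ≤ (61 * H) * lg := by
    refine mul_le_mul_of_nonneg_right ?_ (by linarith)
    linarith
  have h9 : H ≤ H * lg := le_mul_of_one_le_right (by linarith) h5
  linarith

/-! ### Asymptotics -/

theorem tendsto_log_natCast : Tendsto (fun n : ℕ => Real.log n) atTop atTop :=
  Real.tendsto_log_atTop.comp tendsto_natCast_atTop_atTop

theorem isLittleO_log_natCast :
    (fun n : ℕ => Real.log n) =o[atTop] (fun n : ℕ => (n : ℝ)) :=
  Real.isLittleO_log_id_atTop.comp_tendsto tendsto_natCast_atTop_atTop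

theorem isLittleO_log_log_natCast :
    (fun n : ℕ => Real.log (Real.log n)) =o[atTop] (fun n : ℕ => Real.log n) :=
  Real.isLittleO_log_id_atTop.comp_tendsto tendsto_log_natCast

theorem isBigO_logb_natCast :
    (fun n : ℕ => Real.logb 2 n) =O[atTop] (fun n : ℕ => Real.log n) := by
  simp only [Real.logb, div_eq_inv_mul]
  exact (isBigO_refl _ _).const_mul_left _

theorem isBigO_const_log (C : ℝ) : (fun _ : ℕ => C) =O[atTop] (fun n : ℕ => Real.log n) :=
  (isLittleO_const_left.2 (Or.inr (tendsto_abs_atTop_atTop.comp tendsto_log_natCast))).isBigO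

theorem isBigO_coverParam :
    (fun n : ℕ => (coverParam n : ℝ)) =O[atTop] (fun n : ℕ => Real.log n) := by
  have h : (fun n : ℕ => Real.logb 2 n / 8 + 1) =O[atTop] (fun n : ℕ => Real.log n) := by
    simp only [div_eq_inv_mul]
    exact (isBigO_logb_natCast.const_mul_left _).add (isBigO_const_log 1)
  refine (IsBigO.of_bound 1 (Eventually.of_forall fun n => ?_)).trans h
  rw [one_mul, Real.norm_of_nonneg (Nat.cast_nonneg _)]
  exact (coverParam_le n).trans (le_abs_self _)

theorem log_le_eight_mul_coverParam (n : ℕ) : Real.log n ≤ 8 * coverParam n := by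
  have h1 := le_coverParam n
  have h2 : Real.log n ≤ Real.logb 2 n := by
    have h3 := logb_two_natCast_nonneg n
    have h4 := Real.log_two_lt_d9
    have h5 : Real.log n = Real.logb 2 n * Real.log 2 :=
      (div_mul_cancel₀ _ (Real.log_pos one_lt_two).ne').symm
    rw [h5]
    nlinarith
  linarith

/-- If `b` grows at least like the tree covering parameter, then `n / b(n) = O(n / log n)`. -/
theorem isBigO_div_of_coverParam_le {b : ℕ → ℕ} (hb : ∀ n, coverParam n ≤ b n) :
    (fun n : ℕ => (n : ℝ) / b n) =O[atTop] (fun n : ℕ => (n : ℝ) / Real.log n) := by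
  refine IsBigO.of_bound 8 ?_
  filter_upwards [tendsto_log_natCast.eventually_gt_atTop 0] with n hn
  have h1 := log_le_eight_mul_coverParam n
  have h2 : (coverParam n : ℝ) ≤ b n := by exact_mod_cast hb n
  have h3 : (0 : ℝ) < b n := by linarith
  rw [Real.norm_of_nonneg (by positivity), Real.norm_of_nonneg (by positivity),
    div_le_iff₀ h3]
  have : 8 * ((n : ℝ) / Real.log n) * b n = n * (8 * b n / Real.log n) := by ring
  rw [this]
  refine le_mul_of_one_le_right (Nat.cast_nonneg _) ?_
  rw [one_le_div hn]
  linarith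

theorem isBigO_logb_of_isBigO_log {b : ℕ → ℕ} (h2 : ∀ n, 2 ≤ b n)
    (h : (fun n => (b n : ℝ)) =O[atTop] (fun n : ℕ => Real.log n)) :
    (fun n => Real.logb 2 (b n)) =O[atTop] (fun n : ℕ => Real.log (Real.log n)) := by
  obtain ⟨C, hC, hbound⟩ := h.exists_pos
  have hl : (fun n => Real.log (b n)) =O[atTop] (fun n : ℕ => Real.log (Real.log n)) := by
    refine IsBigO.of_bound 2 ?_
    filter_upwards [hbound.bound, tendsto_log_natCast.eventually_gt_atTop 1,
      (Real.tendsto_log_atTop.comp tendsto_log_natCast).eventually_ge_atTop (Real.log C)]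
      with n h3 h4 h5
    have hb2 : (2 : ℝ) ≤ b n := by exact_mod_cast h2 n
    have hlogb : 0 ≤ Real.log (b n) := Real.log_nonneg (by linarith)
    have hLL : 0 ≤ Real.log (Real.log n) := Real.log_nonneg h4.le
    rw [Real.norm_of_nonneg (by linarith), Real.norm_of_nonneg (by linarith)] at h3
    rw [Real.norm_of_nonneg hlogb, Real.norm_of_nonneg hLL]
    have h6 := Real.log_le_log (by linarith) h3
    rw [Real.log_mul hC.ne' (by linarith)] at h6
    simp only [Function.comp_apply] at h5
    linarith
  simp only [Real.logb, div_eq_inv_mul]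
  exact hl.const_mul_left _

/-- There are at most `4 ^ (2β + 1) ≤ 64 √n` shapes, by `β ≤ lg n / 8 + 1`, with `O(log n)` bits for
each. -/
theorem isLittleO_table : (fun n : ℕ => (4 : ℝ) ^ (2 * coverParam n + 1)
    * (32 * coverParam n + 10)) =o[atTop] (fun n : ℕ => (n : ℝ)) := by
  have h1 : (fun n : ℕ => (4 : ℝ) ^ (2 * coverParam n + 1)) =O[atTop]
      (fun n : ℕ => (n : ℝ) ^ (1 / 2 : ℝ)) := by
    refine IsBigO.of_bound 64 ?_
    filter_upwards [eventually_gt_atTop 0] with n hn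
    have hn0 : (0 : ℝ) < n := by exact_mod_cast hn
    rw [Real.norm_of_nonneg (by positivity), Real.norm_of_nonneg (by positivity)]
    have e1 : (4 : ℝ) ^ (2 * coverParam n + 1) = (2 : ℝ) ^ (4 * (coverParam n : ℝ) + 2) := by
      rw [show (4 : ℝ) = 2 ^ 2 by norm_num, ← pow_mul, ← Real.rpow_natCast]
      congr 1
      push_cast
      ring
    have e2 : (2 : ℝ) ^ (Real.logb 2 n * (1 / 2) + 6) = 64 * (n : ℝ) ^ (1 / 2 : ℝ) := by
      rw [Real.rpow_add two_pos, Real.rpow_mul two_pos.le,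
        Real.rpow_logb two_pos (by norm_num) hn0, mul_comm]
      congr 1
      norm_num
    rw [e1, ← e2]
    refine Real.rpow_le_rpow_of_exponent_le one_le_two ?_
    have := coverParam_le n
    linarith
  have h2 : (fun n : ℕ => 32 * (coverParam n : ℝ) + 10) =o[atTop]
      (fun n : ℕ => (n : ℝ) ^ (1 / 2 : ℝ)) := by
    refine ((isBigO_coverParam.const_mul_left _).add (isBigO_const_log 10)).trans_isLittleO ?_
    exact (isLittleO_log_rpow_atTop (by norm_num)).comp_tendsto tendsto_natCast_atTop_atTop
  refine (h1.mul_isLittleO h2).congr_right fun n => ?_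
  rw [← Real.rpow_add_of_nonneg (Nat.cast_nonneg n) (by norm_num) (by norm_num)]
  norm_num

theorem isLittleO_codeRemainder {b : ℕ → ℕ} (h2 : ∀ n, 2 ≤ b n) (hb : ∀ n, coverParam n ≤ b n)
    (h : (fun n => (b n : ℝ)) =O[atTop] (fun n : ℕ => Real.log n)) :
    (fun n => codeRemainder n (b n)) =o[atTop] (fun n : ℕ => (n : ℝ)) := by
  have hlg : (fun n => Real.logb 2 (b n)) =o[atTop] (fun n : ℕ => Real.log n) :=
    (isBigO_logb_of_isBigO_log h2 h).trans_isLittleO isLittleO_log_log_natCast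
  have hdiv : (fun n : ℕ => (n : ℝ) / Real.log n * Real.log n) =O[atTop]
      (fun n : ℕ => (n : ℝ)) := by
    refine IsBigO.of_bound 1 ?_
    filter_upwards [tendsto_log_natCast.eventually_gt_atTop 0] with n hn
    rw [div_mul_cancel₀ _ hn.ne', one_mul]
  have t1 : (fun n : ℕ => 2 * Real.logb 2 n + 3) =o[atTop] (fun n : ℕ => (n : ℝ)) :=
    ((isBigO_logb_natCast.const_mul_left _).add (isBigO_const_log 3)).trans_isLittleO
      isLittleO_log_natCast
  have t3 : (fun n : ℕ => (n : ℝ) / coverParam n * Real.logb 2 (b n)) =o[atTop]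
      (fun n : ℕ => (n : ℝ)) :=
    ((isBigO_div_of_coverParam_le fun n => le_rfl).mul_isLittleO hlg).trans_isBigO hdiv
  have t4 : (fun n : ℕ => (n : ℝ) / b n) =o[atTop] (fun n : ℕ => (n : ℝ)) := by
    have := ((isBigO_div_of_coverParam_le hb).mul_isLittleO
      (isLittleO_const_left (c := (1 : ℝ)) |>.2 (Or.inr
        (tendsto_abs_atTop_atTop.comp tendsto_log_natCast)))).trans_isBigO hdiv
    simpa using this
  have t5 := hlg.trans isLittleO_log_natCast
  refine (((t1.add isLittleO_table).add ((t3.const_mul_left 68).add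
    (t5.const_mul_left 20))).add (t4.const_mul_left 4)).congr_left fun n => ?_
  unfold codeRemainder
  ring

/-- A natural number above `2`, the tree covering parameter and the given fringe parameter. -/
noncomputable def cutoff (B : ℕ → ℝ) (n : ℕ) : ℕ := max (max 2 (coverParam n)) ⌈B n⌉₊

theorem isBigO_cutoff {B : ℕ → ℝ} (hB : B =O[atTop] (fun n : ℕ => Real.log n)) :
    (fun n => (cutoff B n : ℝ)) =O[atTop] (fun n : ℕ => Real.log n) := by
  have h : (fun n : ℕ => (2 + (coverParam n : ℝ)) + (‖B n‖ + 1)) =O[atTop]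
      (fun n : ℕ => Real.log n) :=
    ((isBigO_const_log 2).add isBigO_coverParam).add (hB.norm_left.add (isBigO_const_log 1))
  refine (IsBigO.of_bound 1 (Eventually.of_forall fun n => ?_)).trans h
  have h1 : (⌈B n⌉₊ : ℝ) ≤ ‖B n‖ + 1 := by
    rcases le_total (B n) 0 with hn | hn
    · rw [Nat.ceil_eq_zero.2 hn]
      simp only [Nat.cast_zero]
      positivity
    · rw [Real.norm_of_nonneg hn]
      exact (Nat.ceil_lt_add_one hn).le
  have h2 : (0 : ℝ) ≤ coverParam n := Nat.cast_nonneg _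
  have h3 := norm_nonneg (B n)
  rw [Real.norm_of_nonneg (Nat.cast_nonneg _), Real.norm_of_nonneg (by linarith), one_mul,
    cutoff, Nat.cast_max, Nat.cast_max]
  refine max_le (max_le ?_ ?_) ?_ <;> push_cast <;> linarith

/-- Both logarithms are of order `log log n`: `lg` of the cutoff is at most that, and `log (B n)` is
at least that up to a constant. So the cutoff may replace `B` in the dominance condition. -/
theorem isLittleO_mul_logb_cutoff {B F : ℕ → ℝ} (hB : B =Θ[atTop] (fun n : ℕ => Real.log n))
    (hF : F =o[atTop] (fun n : ℕ => (n : ℝ) / Real.log (B n))) :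
    (fun n => F n * Real.logb 2 (cutoff B n)) =o[atTop] (fun n : ℕ => (n : ℝ)) := by
  have h1 := isBigO_logb_of_isBigO_log (b := cutoff B)
    (fun n => (le_max_left 2 _).trans (le_max_left _ _)) (isBigO_cutoff hB.1)
  have h2 : (fun n : ℕ => Real.log (Real.log n)) =O[atTop] (fun n => Real.log (B n)) := by
    obtain ⟨C, hC, hbound⟩ := hB.2.exists_pos
    refine IsBigO.of_bound 2 ?_
    filter_upwards [hbound.bound, tendsto_log_natCast.eventually_gt_atTop 1,
      (Real.tendsto_log_atTop.comp tendsto_log_natCast).eventually_ge_atTop (2 * Real.log C)]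
      with n h3 h4 h5
    have hLL : 0 ≤ Real.log (Real.log n) := Real.log_nonneg h4.le
    rw [Real.norm_of_nonneg (by linarith), Real.norm_eq_abs] at h3
    have hBpos : 0 < |B n| := by
      by_contra hneg
      nlinarith
    have h6 := Real.log_le_log (by linarith) h3
    rw [Real.log_mul hC.ne' hBpos.ne', Real.log_abs] at h6
    simp only [Function.comp_apply] at h5
    rw [Real.norm_of_nonneg hLL]
    have := Real.le_norm_self (Real.log (B n))
    linarith
  refine (hF.mul_isBigO (h1.trans h2)).trans_isBigO (IsBigO.of_bound 1 ?_)
  refine Eventually.of_forall fun n => ?_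
  -- If `log (B n) = 0`, the quotient `n / log (B n)` has the default value `0`, and the bound still
  -- holds.
  rcases eq_or_ne (Real.log (B n)) 0 with h0 | h0
  · simp [h0]
  · rw [div_mul_cancel₀ _ h0, one_mul]

/-! ### Fringe-dominated sources -/

/-- Raising the threshold from `B n` to the cutoff can only lower the number of heavy nodes. -/
theorem IsSource.length_hypersuccinct_le_of_cutoff {c : ℕ → ℕ → ℕ} {p : ℕ → ℕ → ℝ}
    (h : IsSource c p) (B : ℕ → ℝ) (t : BinaryTree Unit) (ht : 0 < sourceProb c p t) :
    ((hypersuccinct t).length : ℝ) ≤ Real.logb 2 (1 / sourceProb c p t)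
      + (6 * (numHeavy (B t.numNodes) t * Real.logb 2 (cutoff B t.numNodes))
        + codeRemainder t.numNodes (cutoff B t.numNodes)) := by
  have h2 : 2 ≤ cutoff B t.numNodes := (le_max_left 2 _).trans (le_max_left _ _)
  have h1 := h.length_hypersuccinct_le h2 t ((le_max_right 2 _).trans (le_max_left _ _)) ht
  have h3 : (numHeavy (cutoff B t.numNodes) t : ℝ) ≤ numHeavy (B t.numNodes) t := by
    exact_mod_cast numHeavy_anti ((Nat.le_ceil _).trans (by exact_mod_cast le_max_right _ _)) t
  have h4 := mul_le_mul_of_nonneg_right h3 (logb_two_natCast_nonneg (cutoff B t.numNodes))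
  linarith

theorem IsSource.worstCase {c : ℕ → ℕ → ℕ} {p : ℕ → ℕ → ℝ} (h : IsSource c p) {B : ℕ → ℝ}
    (hB : WorstCaseFringeDominated B (sourceProb c p)) :
    ∃ f : ℕ → ℝ, f =o[atTop] (fun n : ℕ => (n : ℝ)) ∧
      ∀ t : BinaryTree Unit, 0 < sourceProb c p t →
        ((hypersuccinct t).length : ℝ) ≤ Real.logb 2 (1 / sourceProb c p t) + f t.numNodes := by
  obtain ⟨hΘ, F, hF, hdom⟩ := hB
  refine ⟨fun n => 6 * (F n * Real.logb 2 (cutoff B n)) + codeRemainder n (cutoff B n),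
    ((isLittleO_mul_logb_cutoff hΘ hF).const_mul_left 6).add (isLittleO_codeRemainder
      (fun n => (le_max_left 2 _).trans (le_max_left _ _))
      (fun n => (le_max_right 2 _).trans (le_max_left _ _)) (isBigO_cutoff hΘ.1)),
    fun t ht => ?_⟩
  have h1 := h.length_hypersuccinct_le_of_cutoff B t ht
  have h2 := mul_le_mul_of_nonneg_right (hdom t ht)
    (logb_two_natCast_nonneg (cutoff B t.numNodes))
  linarith

/-- At `ε = 0` the process `lightMass` never stops early, so the total mass of the trees of one size
is bounded by `IsSource.sum_lightMass_le_one`. -/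
theorem IsSource.sourceProb_le_lightMass {c : ℕ → ℕ → ℕ} {p : ℕ → ℕ → ℝ} (h : IsSource c p)
    (t : BinaryTree Unit) : sourceProb c p t ≤ lightMass c p 0 t (treeParam c t) := by
  induction t with
  | nil => simp [sourceProb, lightMass, treeParam]
  | node a l r hl hr =>
    refine le_trans ?_ (h.lightMass_node_ge le_rfl zero_le_one l r _ _)
    rw [sub_zero, one_mul, sourceProb]
    exact mul_le_mul (mul_le_mul_of_nonneg_left hl (h.nonneg _ _)) hr (h.sourceProb_nonneg r)
      (mul_nonneg (h.nonneg _ _) (h.lightMass_nonneg le_rfl zero_le_one _ _))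

theorem IsFixedSizeSource.sum_fixedSizeProb_le_one {p : ℕ → ℕ → ℝ} (h : IsFixedSizeSource p)
    (n : ℕ) : ∑ t ∈ BinaryTree.treesOfNumNodesEq n, fixedSizeProb p t ≤ 1 := by
  refine le_trans (Finset.sum_le_sum fun t ht => ?_)
    ((Finset.sum_le_sum_of_subset_of_nonneg (fun t ht => mem_treesOfHeightLE ?_) fun t _ _ =>
      h.isSource.lightMass_nonneg le_rfl zero_le_one t n).trans
      (h.isSource.sum_lightMass_le_one le_rfl zero_le_one n n))
  · rw [← sourceProb_size, ← BinaryTree.mem_treesOfNumNodesEq.1 ht, ← treeParam_size]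
    exact h.isSource.sourceProb_le_lightMass t
  · exact (BinaryTree.height_le_numNodes t).trans (BinaryTree.mem_treesOfNumNodesEq.1 ht).le

/-- The bound for single trees is averaged; trees of probability `0` contribute nothing, and since
the remainder is nonnegative, total probability at most `1` suffices. -/
theorem IsFixedSizeSource.averageCase {p : ℕ → ℕ → ℝ} (h : IsFixedSizeSource p) {B : ℕ → ℝ}
    (hB : AverageCaseFringeDominated B (fixedSizeProb p)) :
    ∃ f : ℕ → ℝ, f =o[atTop] (fun n : ℕ => (n : ℝ)) ∧
      ∀ n : ℕ, ∑ t ∈ BinaryTree.treesOfNumNodesEq n,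
          fixedSizeProb p t * ((hypersuccinct t).length : ℝ)
        ≤ sizeEntropy (fixedSizeProb p) n + f n := by
  obtain ⟨hΘ, hF⟩ := hB
  refine ⟨fun n => 6 * ((∑ t ∈ BinaryTree.treesOfNumNodesEq n,
      fixedSizeProb p t * (numHeavy (B n) t : ℝ)) * Real.logb 2 (cutoff B n))
        + codeRemainder n (cutoff B n),
    ((isLittleO_mul_logb_cutoff hΘ hF).const_mul_left 6).add (isLittleO_codeRemainder
      (fun n => (le_max_left 2 _).trans (le_max_left _ _))
      (fun n => (le_max_right 2 _).trans (le_max_left _ _)) (isBigO_cutoff hΘ.1)),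
    fun n => ?_⟩
  have hR := codeRemainder_nonneg n (b := cutoff B n)
    ((le_max_left 2 _).trans (le_max_left _ _))
  have key : ∀ t ∈ BinaryTree.treesOfNumNodesEq n,
      fixedSizeProb p t * ((hypersuccinct t).length : ℝ)
        ≤ fixedSizeProb p t * Real.logb 2 (1 / fixedSizeProb p t)
          + (6 * (fixedSizeProb p t * (numHeavy (B n) t : ℝ) * Real.logb 2 (cutoff B n))
            + fixedSizeProb p t * codeRemainder n (cutoff B n)) := by
    intro t ht
    have hP : 0 ≤ fixedSizeProb p t := sourceProb_size p ▸ h.isSource.sourceProb_nonneg t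
    rcases hP.eq_or_lt with h0 | hpos
    · simp [← h0]
    · have h1 := h.isSource.length_hypersuccinct_le_of_cutoff B t
        (by rw [sourceProb_size]; exact hpos)
      rw [sourceProb_size, BinaryTree.mem_treesOfNumNodesEq.1 ht] at h1
      refine (mul_le_mul_of_nonneg_left h1 hP).trans (le_of_eq ?_)
      ring
  refine (Finset.sum_le_sum key).trans ?_
  rw [Finset.sum_add_distrib, Finset.sum_add_distrib, ← Finset.mul_sum, ← Finset.sum_mul,
    ← Finset.sum_mul, sizeEntropy]
  have := mul_le_mul_of_nonneg_right (h.sum_fixedSizeProb_le_one n) hR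
  linarith

end Hypersuccinct
theorem mainTheorem8 :
    -- worst-case fringe dominance, fixed-size sources
    (∀ (p : ℕ → ℕ → ℝ) (B : ℕ → ℝ), Hypersuccinct.IsFixedSizeSource p →
      Hypersuccinct.WorstCaseFringeDominated B (Hypersuccinct.fixedSizeProb p) →
      ∃ f : ℕ → ℝ, f =o[atTop] (fun n : ℕ => (n : ℝ)) ∧
        ∀ t : BinaryTree Unit, 0 < Hypersuccinct.fixedSizeProb p t →
          ((Hypersuccinct.hypersuccinct t).length : ℝ)
            ≤ Real.logb 2 (1 / Hypersuccinct.fixedSizeProb p t) + f t.numNodes) ∧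
    -- worst-case fringe dominance, fixed-height sources
    (∀ (p : ℕ → ℕ → ℝ) (B : ℕ → ℝ), Hypersuccinct.IsFixedHeightSource p →
      Hypersuccinct.WorstCaseFringeDominated B (Hypersuccinct.fixedHeightProb p) →
      ∃ f : ℕ → ℝ, f =o[atTop] (fun n : ℕ => (n : ℝ)) ∧
        ∀ t : BinaryTree Unit, 0 < Hypersuccinct.fixedHeightProb p t →
          ((Hypersuccinct.hypersuccinct t).length : ℝ)
            ≤ Real.logb 2 (1 / Hypersuccinct.fixedHeightProb p t) + f t.numNodes) ∧
    -- average-case fringe dominance, fixed-size sources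
    (∀ (p : ℕ → ℕ → ℝ) (B : ℕ → ℝ), Hypersuccinct.IsFixedSizeSource p →
      Hypersuccinct.AverageCaseFringeDominated B (Hypersuccinct.fixedSizeProb p) →
      ∃ f : ℕ → ℝ, f =o[atTop] (fun n : ℕ => (n : ℝ)) ∧
        ∀ n : ℕ, ∑ t ∈ BinaryTree.treesOfNumNodesEq n,
            Hypersuccinct.fixedSizeProb p t * ((Hypersuccinct.hypersuccinct t).length : ℝ)
          ≤ Hypersuccinct.sizeEntropy (Hypersuccinct.fixedSizeProb p) n + f n) ∧
    -- the great-branching bound, with constants that do not depend on the source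
    (∃ (K : ℝ) (N : ℕ), ∀ (p : ℕ → ℕ → ℝ) (P : BinaryTree Unit → ℝ),
      (Hypersuccinct.IsFixedSizeSource p ∧ P = Hypersuccinct.fixedSizeProb p ∨
        Hypersuccinct.IsFixedHeightSource p ∧ P = Hypersuccinct.fixedHeightProb p) →
      ∀ t : BinaryTree Unit, N ≤ t.numNodes → 0 < P t →
        (Hypersuccinct.microTreeCodeLength t : ℝ)
          ≤ Real.logb 2 (1 / P t)
            + K * ((Hypersuccinct.numHeavy (Hypersuccinct.coverParam t.numNodes) t : ℝ)
                * Real.logb 2 (Hypersuccinct.coverParam t.numNodes))) := by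
  refine ⟨fun p B hp hB => ?_, fun p B hp hB => ?_, fun p B hp hB => hp.averageCase hB,
    73, 2 ^ 9, ?_⟩
  · rw [← Hypersuccinct.sourceProb_size] at hB ⊢
    exact hp.isSource.worstCase hB
  · rw [← Hypersuccinct.sourceProb_height] at hB ⊢
    exact hp.isSource.worstCase hB
  · rintro p P (⟨hp, rfl⟩ | ⟨hp, rfl⟩) t hn ht
    · rw [← Hypersuccinct.sourceProb_size] at ht ⊢
      exact hp.isSource.microTreeCodeLength_le t hn ht
    · rw [← Hypersuccinct.sourceProb_height] at ht ⊢
      exact hp.isSource.microTreeCodeLength_le t hn ht
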